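/- Let $d,n\ge 1$, let $A_1,\dots,A_d$ be real $n\times n$ matrices such that $\boldsymbol A\cdot\boldsymbol v=\sum_i v_iA_i$ is diagonalizable with real eigenvalues for each $\boldsymbol v\in\mathbb R^d$, and consider the system $\partial_t w+\boldsymbol A\cdot\nabla w=0$. Let $\mathbb R^d$ be covered by a mesh with polytopal elements $K_j$, $j\in\mathcal E$, with disjoint interiors, invariant under the translations by integer vectors and with finitely many elements up to these translations. Let $\boldsymbol r_j$ be the mass center of $K_j$; let $N(j)$ be the set of $k\ne j$ such that $\partial K_j\cap\partial K_k$ has nonzero $(d-1)$-dimensional measure; assume that for $k\in N(j)$ this face is planar, with $K_j$ and $K_k$ on its two sides; let $\boldsymbol r_{jk}$ be its mass center and $\boldsymbol n_{jk}$ the integral over it of the unit normal oriented inside $K_k$. Let $A(j)$ be the set of elements having at least one common vertex with $j$. Scheme BBR3. For $k\in N(j)$ consider the ray originating at $\boldsymbol r_{jk}$ and passing through $\boldsymbol r_j\ne\boldsymbol r_{jk}$. Let $\boldsymbol r_{jk}^-$ be the intersection, furthest from $\boldsymbol r_j$, of the part of this ray strictly beyond $\boldsymbol r_j$ with the nondegenerate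 $(d-1)$-simplexes (segments if $d=2$, points if $d=1$) whose vertices are mass centers of elements of $A(j)$. Let $\boldsymbol r_{jk}^+$ be the intersection, furthest from $\boldsymbol r_j$, of the opposite ray originating at $\boldsymbol r_{jk}$ with the nondegenerate $(d-1)$-simplexes having $\boldsymbol r_k$ as one vertex and mass centers of elements of $A(j)$ as the others. For a mesh function $u=\{u_j\in\mathbb C^n\}$ let $u_{jk}^\pm$ be obtained by linear interpolation to $\boldsymbol r_{jk}^\pm$ over such a simplex containing $\boldsymbol r_{jk}^\pm$; if there are several such simplexes, any choice invariant under the integer translations is allowed. Put $$\mathcal R_{jk}[u]=u_j+|\boldsymbol r_{jk}-\boldsymbol r_j|\left(\frac23\,\frac{u_{jk}^+-u_j}{|\boldsymbol r_{jk}^+-\boldsymbol r_j|}+\frac13\,\frac{u_j-u_{jk}^-}{|\boldsymbol r_j-\boldsymbol r_{jk}^-|}\right)$$ if both points are defined, and $\mathcal R_{jk}[u]=u_j$ otherwise, $$F_{jk}[u]=\frac{\boldsymbol A\cdot\boldsymbol n_{jk}+|\boldsymbol A\cdot\boldsymbol n_{jk}|}{2}\mathcal R_{jk}[u]+\frac{\boldsymbol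 A\cdot\boldsymbol n_{jk}-|\boldsymbol A\cdot\boldsymbol n_{jk}|}{2}\mathcal R_{kj}[u],$$ where $|M|=S|\Lambda|S^{-1}$ for $M=S\Lambda S^{-1}$ with $\Lambda$ real diagonal. The scheme is $\frac{du_j}{dt}+\frac1{|K_j|}\sum_{k\in N(j)}F_{jk}[u]=0$. Its truncation error on $f:\mathbb R^d\to\mathbb C^n$ is $$\epsilon_j(f)=-(\boldsymbol A\cdot\nabla f)(\boldsymbol r_j)+\frac1{|K_j|}\sum_{k\in N(j)}F_{jk}[\Pi f],\qquad (\Pi f)_j=f(\boldsymbol r_j).$$ Proposition. Suppose that the points $\boldsymbol r_{jk}^{+}$ and $\boldsymbol r_{jk}^-$ are defined for all $j\in\mathcal E$ and $k\in N(j)$. Then BBR3 is 1-exact, that is, $\epsilon_j(f)=0$ for each $j\in\mathcal E$ and each $f$ whose components are polynomials of degree at most $1$; and it has zero mean error on the second order polynomials, that is, $\sum_{j\in\mathcal E^1}|K_j|\,\epsilon_j(f)=0$ for each $f$ whose components are polynomials of degree at most $2$, where $\mathcal E^1$ contains one element of each class of elements that are equal up to integer translations. -/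

import Mathlib

open MeasureTheory

noncomputable section

namespace BBR

/-- The Euclidean space `ℝ^d`. -/
abbrev Space (d : ℕ) : Type := EuclideanSpace ℝ (Fin d)

/-- The vector of `ℝ^d` with the given integer components. -/
def intVec {d : ℕ} (z : Fin d → ℤ) : Space d := WithLp.toLp 2 (fun i => (z i : ℝ))

/-! ### Periodic polytopal meshes -/

/-- A (not necessarily convex) nondegenerate polytope with planar faces: a nonempty compact set
which is the closure of its interior and whose boundary lies in finitely many hyperplanes. -/
structure IsPolytope {d : ℕ} (K : Set (Space d)) : Prop where
  nonempty : K.Nonempty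
  isCompact : IsCompact K
  closure_interior : closure (interior K) = K
  frontier_subset : ∃ H : Finset (Space d × ℝ), (∀ h ∈ H, h.1 ≠ 0) ∧
    ∀ x ∈ frontier K, ∃ h ∈ H, inner ℝ h.1 x = h.2

/-- `x` is a corner (a zero-dimensional face) of the polytope `K`: there is no direction `v ≠ 0`
along which `K` is invariant under small translations near `x`. -/
def IsCorner {d : ℕ} (K : Set (Space d)) (x : Space d) : Prop :=
  x ∈ K ∧ ∀ v : Space d, v ≠ 0 →
    ¬ ∃ ε > 0, ∀ y ∈ Metric.ball x ε, ∀ t : ℝ, |t| < ε → (y ∈ K ↔ y + t • v ∈ K)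

/-- A mesh of `ℝ^d` invariant under the translations by integer vectors. The finite type `B` indexes
the mesh elements up to these translations, so the elements are indexed by `ℤ^d × B`.
A node that lies in an element is a vertex of this element (there are no hanging nodes). -/
structure PeriodicMesh (d : ℕ) (B : Type*) where
  /-- the shape `K_j` of the element `j` -/
  cell : (Fin d → ℤ) × B → Set (Space d)
  /-- the set of the radius-vectors of the mesh nodes -/
  nodes : Set (Space d)
  isPolytope : ∀ j, IsPolytope (cell j)
  cell_shift : ∀ (z w : Fin d → ℤ) (b : B),
    cell (z + w, b) = (fun x => intVec z + x) '' cell (w, b)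
  cover : (⋃ j, cell j) = Set.univ
  disjoint : ∀ j k, j ≠ k → Disjoint (interior (cell j)) (interior (cell k))
  nodes_shift : ∀ (z : Fin d → ℤ) (x : Space d), intVec z + x ∈ nodes ↔ x ∈ nodes
  nodes_finite : ∀ j, (nodes ∩ cell j).Finite
  nodes_frontier : ∀ j, ∀ x ∈ nodes ∩ cell j, x ∈ frontier (cell j)
  corner_mem_nodes : ∀ j x, IsCorner (cell j) x → x ∈ nodes

namespace PeriodicMesh

variable {d : ℕ} {B : Type*} (T : PeriodicMesh d B)

/-- The set of mesh elements; for a cell-centered scheme it is also the set of control volumes. -/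
abbrev Elem (_T : PeriodicMesh d B) : Type _ := (Fin d → ℤ) × B

/-- The translation of the element `j` by the integer vector `z`. -/
def shift (z : Fin d → ℤ) (j : T.Elem) : T.Elem := (z + j.1, j.2)

/-- The measure `|K_j|`. -/
def vol (j : T.Elem) : ℝ := volume.real (T.cell j)

/-- The mass center `r_j` of the element `j`. -/
def center (j : T.Elem) : Space d := ⨍ x in T.cell j, x

/-- The common boundary `∂K_j ∩ ∂K_k`. -/
def face (j k : T.Elem) : Set (Space d) := frontier (T.cell j) ∩ frontier (T.cell k)

/-- `N(j)`: the elements `k ≠ j` such that `∂K_j ∩ ∂K_k` has nonzero `(d-1)`-dimensional measure. -/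
def nbr (j : T.Elem) : Set T.Elem := {k | k ≠ j ∧ μHE[d - 1] (T.face j k) ≠ 0}

/-- The mass center `r_jk` of the face `∂K_j ∩ ∂K_k`. -/
def faceCenter (j k : T.Elem) : Space d := ⨍ x in T.face j k, x ∂μHE[d - 1]

/-- `ν` is the unit normal at the point `x` of the common boundary of `K_j` and `K_k`, oriented
inside `K_k`: near `x`, `K_k` contains the open half-space in front of `x` and `K_j` the open
half-space behind it. This holds at all points of the common boundary apart from the
edges of dimension at most `d - 2`. -/
def IsUnitNormal (j k : T.Elem) (x ν : Space d) : Prop :=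
  ‖ν‖ = 1 ∧ ∃ ε > 0, ∀ y ∈ Metric.ball x ε,
    (0 < inner ℝ ν (y - x) → y ∈ T.cell k) ∧ (inner ℝ ν (y - x) < 0 → y ∈ T.cell j)

open Classical in
/-- The unit normal at `x`, oriented from `K_j` to `K_k` (zero where there is none). -/
def unitNormal (j k : T.Elem) (x : Space d) : Space d :=
  if h : ∃ ν, T.IsUnitNormal j k x ν then h.choose else 0

/-- The vector `n_jk`, the integral over `∂K_j ∩ ∂K_k` of the unit normal oriented inside `K_k`. -/
def faceNormal (j k : T.Elem) : Space d := ∫ x in T.face j k, T.unitNormal j k x ∂μHE[d - 1]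

/-- Each face `∂K_j ∩ ∂K_k`, `k ∈ N(j)`, is planar: up to a set of zero `(d-1)`-dimensional measure
it lies in one hyperplane, on one side of which is `K_j` and on the other side `K_k`. -/
def PlanarFaces : Prop :=
  ∀ j, ∀ k ∈ T.nbr j, ∃ (ν : Space d) (c : ℝ),
    ∀ᵐ x ∂((μHE[d - 1] : Measure (Space d)).restrict (T.face j k)),
      inner ℝ ν x = c ∧ T.IsUnitNormal j k x ν

/-- `A(j)`: the elements having at least one common vertex with `j`. -/
def vertexNbr (j : T.Elem) : Set T.Elem := {m | (T.nodes ∩ T.cell j ∩ T.cell m).Nonempty}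

/-- The sets `N(j)` are finite. -/
theorem nbr_finite [Finite B] (j : T.Elem) : (T.nbr j).Finite := by
  classical
  have hb : ∀ b : B, ∃ R : ℝ, ∀ x ∈ T.cell (0, b), ‖x‖ ≤ R := fun b =>
    (T.isPolytope (0, b)).isCompact.isBounded.exists_norm_le
  choose R hR using hb
  obtain ⟨M, hM⟩ : ∃ M, ∀ b, R b ≤ M := by
    obtain ⟨M, hM⟩ := (Set.finite_range R).bddAbove
    exact ⟨M, fun b => hM ⟨b, rfl⟩⟩
  obtain ⟨Rj, hRj⟩ := (T.isPolytope j).isCompact.isBounded.exists_norm_le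
  have hfin : (Set.pi Set.univ (fun _ : Fin d => Set.Icc (-⌈M + Rj⌉) ⌈M + Rj⌉)).Finite :=
    Set.Finite.pi fun _ => Set.finite_Icc _ _
  refine ((hfin.prod (Set.finite_univ (α := B)))).subset ?_
  rintro ⟨w, b⟩ ⟨-, hk⟩
  refine ⟨?_, Set.mem_univ _⟩
  obtain ⟨x, hxj, hxk⟩ := nonempty_of_measure_ne_zero hk
  have hxj := (T.isPolytope j).isCompact.isClosed.frontier_subset hxj
  have hxk := (T.isPolytope (w, b)).isCompact.isClosed.frontier_subset hxk
  have hs := T.cell_shift w 0 b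
  rw [add_zero] at hs
  rw [hs] at hxk
  obtain ⟨y, hy, rfl⟩ := hxk
  have h1 := hRj _ hxj
  have h2 := (hR b y hy).trans (hM b)
  have h3 : ‖(intVec w : Space d)‖ ≤ M + Rj := by
    have : (intVec w : Space d) = (intVec w + y) - y := by abel
    rw [this]
    exact (norm_sub_le _ _).trans (by simp only at h1; linarith)
  intro i _
  have h4 : |(w i : ℝ)| ≤ M + Rj := by
    have := PiLp.norm_apply_le (intVec w : Space d) i
    simp only [intVec, Real.norm_eq_abs] at this
    exact this.trans h3
  have h5 : |(w i : ℝ)| ≤ (⌈M + Rj⌉ : ℤ) := h4.trans (Int.le_ceil _)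
  rw [abs_le] at h5
  exact ⟨by exact_mod_cast h5.1, by exact_mod_cast h5.2⟩

/-! ### The points `r_jk^±` -/

/-- `σ` is the set of vertices of a nondegenerate `(d-1)`-simplex with vertices at the mass
centers of the elements of the set `S` (a segment with two distinct ends if `d = 2`). -/
def IsSimplex (S : Set T.Elem) (σ : Finset T.Elem) : Prop :=
  σ.card = d ∧ (∀ m ∈ σ, m ∈ S) ∧ AffineIndependent ℝ (fun m : σ => T.center m)

/-- The closed simplex spanned by the mass centers of the elements of `σ`. -/
def hull (σ : Finset T.Elem) : Set (Space d) := convexHull ℝ (T.center '' (σ : Set T.Elem))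

/-- The `(d-1)`-simplexes used to define `r_jk^-`: all their vertices correspond to elements
of `A(j)`. -/
def IsMinusSimplex (j : T.Elem) (σ : Finset T.Elem) : Prop :=
  T.IsSimplex (T.vertexNbr j) σ

/-- The `(d-1)`-simplexes used to define `r_jk^+`: one vertex is `r_k`, the others correspond to
elements of `A(j)`. -/
def IsPlusSimplex (j k : T.Elem) (σ : Finset T.Elem) : Prop :=
  k ∈ σ ∧ T.IsSimplex (insert k (T.vertexNbr j)) σ

/-- The point of the line passing through `r_jk` and `r_j` with the coordinate `t`; the coordinate
is `0` at `r_j` and `1` at `r_jk`. -/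
def linePoint (j k : T.Elem) (t : ℝ) : Space d :=
  T.center j + t • (T.faceCenter j k - T.center j)

/-- The ray from `r_jk` through `r_j`, beyond the point `r_j`: distances to `r_j` (in the units of
`|r_jk - r_j|`) of its intersections with the simplexes. -/
def minusParams (j k : T.Elem) : Set ℝ :=
  {t | 0 < t ∧ ∃ σ, T.IsMinusSimplex j σ ∧ T.linePoint j k (-t) ∈ T.hull σ}

/-- The ray from `r_jk` in the opposite direction: distances to `r_j` (in the units of
`|r_jk - r_j|`) of its intersections with the simplexes. -/
def plusParams (j k : T.Elem) : Set ℝ :=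
  {t | 1 ≤ t ∧ ∃ σ, T.IsPlusSimplex j k σ ∧ T.linePoint j k t ∈ T.hull σ}

/-- The point `r_jk^-` is defined: there is an intersection furthest from `r_j`. (If `r_jk = r_j`,
then there is no ray, and nothing is furthest.) -/
def MinusDefined (j k : T.Elem) : Prop := ∃ t, IsGreatest (T.minusParams j k) t

/-- The point `r_jk^+` is defined: there is an intersection furthest from `r_j`. -/
def PlusDefined (j k : T.Elem) : Prop := ∃ t, IsGreatest (T.plusParams j k) t

/-- The point `r_jk^-`, the intersection furthest from `r_j`. -/
def rMinus (j k : T.Elem) : Space d := T.linePoint j k (-sSup (T.minusParams j k))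

/-- The point `r_jk^+`, the intersection furthest from `r_j`. -/
def rPlus (j k : T.Elem) : Space d := T.linePoint j k (sSup (T.plusParams j k))

/-- A choice, invariant under the mesh translations, of simplexes that contain the points `r_jk^±`
(there may be several such simplexes). -/
structure SimplexChoice where
  minus : T.Elem → T.Elem → Finset T.Elem
  plus : T.Elem → T.Elem → Finset T.Elem
  minus_shift : ∀ z j k m,
    T.shift z m ∈ minus (T.shift z j) (T.shift z k) ↔ m ∈ minus j k
  plus_shift : ∀ z j k m,
    T.shift z m ∈ plus (T.shift z j) (T.shift z k) ↔ m ∈ plus j k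
  minus_spec : ∀ j, ∀ k ∈ T.nbr j, T.MinusDefined j k →
    T.IsMinusSimplex j (minus j k) ∧ T.rMinus j k ∈ T.hull (minus j k)
  plus_spec : ∀ j, ∀ k ∈ T.nbr j, T.PlusDefined j k →
    T.IsPlusSimplex j k (plus j k) ∧ T.rPlus j k ∈ T.hull (plus j k)

/-! ### The scheme -/

variable {n : ℕ}

/-- Mesh functions with `n` complex components. -/
abbrev MeshFun (T : PeriodicMesh d B) (n : ℕ) : Type _ := T.Elem → Fin n → ℂ

open Classical in
/-- Linear interpolation by the simplex `σ` to the point `x`: the combination of the values of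
`u` with the barycentric coordinates of `x`. -/
def interp (σ : Finset T.Elem) (x : Space d) (u : T.MeshFun n) : Fin n → ℂ :=
  if h : ∃ w : T.Elem → ℝ, ∑ m ∈ σ, w m = 1 ∧ ∑ m ∈ σ, w m • T.center m = x then
    ∑ m ∈ σ, h.choose m • u m
  else 0

open Classical in
/-- The reconstruction `R_jk[u]` of BBR3. -/
def recon (C : T.SimplexChoice) (u : T.MeshFun n) (j k : T.Elem) : Fin n → ℂ :=
  if T.MinusDefined j k ∧ T.PlusDefined j k then
    u j + ‖T.faceCenter j k - T.center j‖ •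
      ((2 / 3 : ℝ) • (‖T.rPlus j k - T.center j‖⁻¹ •
          (T.interp (C.plus j k) (T.rPlus j k) u - u j)) +
        (1 / 3 : ℝ) • (‖T.center j - T.rMinus j k‖⁻¹ •
          (u j - T.interp (C.minus j k) (T.rMinus j k) u)))
  else u j

end PeriodicMesh

/-- `M = S Λ S⁻¹`, where `Λ` is the real diagonal matrix with the entries `l`. -/
def IsDiagonalization {n : ℕ} (M S : Matrix (Fin n) (Fin n) ℝ) (l : Fin n → ℝ) : Prop :=
  IsUnit S.det ∧ M = S * Matrix.diagonal l * S⁻¹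

open Classical in
/-- `|M| = S |Λ| S⁻¹` for a real-diagonalizable matrix `M = S Λ S⁻¹`. -/
def matAbs {n : ℕ} (M : Matrix (Fin n) (Fin n) ℝ) : Matrix (Fin n) (Fin n) ℝ :=
  if h : ∃ p : Matrix (Fin n) (Fin n) ℝ × (Fin n → ℝ), IsDiagonalization M p.1 p.2 then
    h.choose.1 * Matrix.diagonal (fun i => |h.choose.2 i|) * h.choose.1⁻¹
  else 0

/-- The matrix `|M|` does not depend on the choice of `S` and `Λ`. -/
theorem matAbs_eq {n : ℕ} {M S : Matrix (Fin n) (Fin n) ℝ} {l : Fin n → ℝ}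
    (hM : IsDiagonalization M S l) :
    matAbs M = S * Matrix.diagonal (fun i => |l i|) * S⁻¹ := by
  have h : ∃ p : Matrix (Fin n) (Fin n) ℝ × (Fin n → ℝ), IsDiagonalization M p.1 p.2 :=
    ⟨(S, l), hM⟩
  rw [matAbs, dif_pos h]
  obtain ⟨hT, hT'⟩ := h.choose_spec
  set T := h.choose.1
  set l' := h.choose.2
  obtain ⟨hS, hS'⟩ := hM
  have e1 : T⁻¹ * S * Matrix.diagonal l = Matrix.diagonal l' * (T⁻¹ * S) := by
    have : S * Matrix.diagonal l * S⁻¹ = T * Matrix.diagonal l' * T⁻¹ := hS'.symm.trans hT'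
    have h2 := congrArg (fun X => T⁻¹ * X * S) this
    simp only [Matrix.mul_assoc, Matrix.nonsing_inv_mul S hS, Matrix.mul_one,
      Matrix.nonsing_inv_mul_cancel_left T _ hT] at h2
    simpa only [Matrix.mul_assoc] using h2
  have e2 : T⁻¹ * S * Matrix.diagonal (fun i => |l i|)
      = Matrix.diagonal (fun i => |l' i|) * (T⁻¹ * S) := by
    ext i j
    have h3 := congrFun (congrFun e1 i) j
    rw [Matrix.mul_diagonal, Matrix.diagonal_mul] at h3 ⊢
    by_cases h0 : (T⁻¹ * S) i j = 0
    · simp [h0]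
    · have : l j = l' i := mul_left_cancel₀ h0 (by rw [h3, mul_comm])
      rw [this, mul_comm]
  have h4 := congrArg (fun X => T * X * S⁻¹) e2
  simp only [Matrix.mul_assoc, Matrix.mul_nonsing_inv S hS, Matrix.mul_one,
    Matrix.mul_nonsing_inv_cancel_left T _ hT] at h4
  simpa only [Matrix.mul_assoc] using h4.symm

variable {d n : ℕ} {B : Type*}

/-- The matrix `A · v = v_1 A_1 + … + v_d A_d`. -/
def dirMat (A : Fin d → Matrix (Fin n) (Fin n) ℝ) (v : Space d) : Matrix (Fin n) (Fin n) ℝ :=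
  ∑ i, v i • A i

/-- The system `∂w/∂t + A · ∇w = 0` is hyperbolic: the matrix `A · v` is diagonalizable with real
eigenvalues for each vector `v`. -/
def IsHyperbolic (A : Fin d → Matrix (Fin n) (Fin n) ℝ) : Prop :=
  ∀ v : Space d, ∃ S l, IsDiagonalization (dirMat A v) S l

/-- The action of a real matrix on `ℂ^n`. -/
def act (M : Matrix (Fin n) (Fin n) ℝ) (x : Fin n → ℂ) : Fin n → ℂ :=
  (M.map (fun a => (a : ℂ))).mulVec x

/-- The function `A · ∇f`. -/
def advect (A : Fin d → Matrix (Fin n) (Fin n) ℝ) (f : Space d → Fin n → ℂ) (x : Space d) :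
    Fin n → ℂ :=
  ∑ i, act (A i) (fderiv ℝ f x (EuclideanSpace.single i 1))

namespace PeriodicMesh

variable (T : PeriodicMesh d B)

/-- The upwind numerical flux `F_jk[u]` of BBR3. -/
def flux (A : Fin d → Matrix (Fin n) (Fin n) ℝ) (C : T.SimplexChoice) (u : T.MeshFun n)
    (j k : T.Elem) : Fin n → ℂ :=
  act ((1 / 2 : ℝ) • (dirMat A (T.faceNormal j k) + matAbs (dirMat A (T.faceNormal j k))))
      (T.recon C u j k) +
    act ((1 / 2 : ℝ) • (dirMat A (T.faceNormal j k) - matAbs (dirMat A (T.faceNormal j k))))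
      (T.recon C u k j)

/-- The spatial operator of the scheme BBR3, which is
`du_j/dt + (1/|K_j|) ∑_{k ∈ N(j)} F_jk[u] = 0`. -/
def spatialOp [Finite B] (A : Fin d → Matrix (Fin n) (Fin n) ℝ) (C : T.SimplexChoice)
    (u : T.MeshFun n) : T.MeshFun n :=
  fun j => (T.vol j)⁻¹ • ∑ k ∈ (T.nbr_finite j).toFinset, T.flux A C u j k

/-- The map `Π`: the point values at the mass centers of the elements. -/
def pointValues (f : Space d → Fin n → ℂ) : T.MeshFun n := fun j => f (T.center j)

/-- The truncation error `ε(f, Π) = -Π(A · ∇f) + L Π f` of a scheme `du/dt + L u = 0`. -/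
def truncError (A : Fin d → Matrix (Fin n) (Fin n) ℝ) (L : T.MeshFun n → T.MeshFun n)
    (f : Space d → Fin n → ℂ) : T.MeshFun n :=
  fun j => -(T.pointValues (advect A f) j) + L (T.pointValues f) j

end PeriodicMesh

/-- `f ∈ (P_p)^n`: each component of `f` is a polynomial of degree at most `p` with complex
coefficients. -/
def IsPoly (p : ℕ) (f : Space d → Fin n → ℂ) : Prop :=
  ∃ q : Fin n → MvPolynomial (Fin d) ℂ, (∀ i, (q i).totalDegree ≤ p) ∧
    ∀ x i, f x i = MvPolynomial.eval (fun l => (x l : ℂ)) (q i)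

namespace PeriodicMesh

variable (T : PeriodicMesh d B)

/-- The scheme `du/dt + L u = 0` is `p`-exact. -/
def IsExact (A : Fin d → Matrix (Fin n) (Fin n) ℝ) (L : T.MeshFun n → T.MeshFun n) (p : ℕ) :
    Prop :=
  ∀ f : Space d → Fin n → ℂ, IsPoly p f → ∀ j, T.truncError A L f j = 0

/-- The scheme `du/dt + L u = 0` has zero mean error on the polynomials of order `q`; the mean is
taken over the elements up to the integer translations. -/
def HasZeroMeanError [Fintype B] (A : Fin d → Matrix (Fin n) (Fin n) ℝ)
    (L : T.MeshFun n → T.MeshFun n) (q : ℕ) : Prop :=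
  ∀ f : Space d → Fin n → ℂ, IsPoly q f →
    ∑ b : B, T.vol (0, b) • T.truncError A L f (0, b) = 0

end PeriodicMesh

end BBR

end

/-! For a face between `j` and `k`, let the flux defect D_jk(f) be the numerical flux F_jk[Πf] minus
A·n_jk applied to the mean of f over the face. If f is quadratic, A·∇f is affine, so its integral
over K_j is |K_j| times its value at the mass center. The divergence theorem turns that integral
into the sum of the exact face fluxes, hence |K_j| ε_j(f) is the sum of D_jk(f) over k in N(j)
(`PlanarFaces.vol_smul_truncError`).

For affine f, both one-sided slopes in the reconstruction equal the directional derivative of f, and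
2/3 + 1/3 = 1, so R_jk and R_kj both give f(r_jk). The upwind terms cancel, D_jk(f) = 0, and
1-exactness follows.

For quadratic f, the difference of f and its translate is affine. Since the scheme is translation
invariant and D vanishes on affine functions, D_jk(f) depends on the pair (j, k) only up to integer
translations. The flux is conservative, D_kj = -D_jk, because n_kj = -n_jk and |-M| = |M|. Summed
over one period, the defects cancel in pairs (`PlanarFaces.hasZeroMeanError_two`).

Much of the work is the divergence theorem for nonconvex polytopes whose faces are known only up to
null sets. It is proved by slicing along lines of a generic direction e: the indicator of K is a
signed sum of indicators of the "shadows" cast by the faces against e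
(`halfIndicator_eq_sum_heaviside`), and Fubini evaluates the integral of the derivative along e over
each shadow (`setIntegral_shadow`). -/

namespace BBR

/-! ### Fubini's theorem for slicing by lines transversal to a hyperplane. -/

section Hyperplane

variable {d : ℕ} {ν e : Space d} {c : ℝ}

/-- The normalized Hausdorff measure is carried along by isometries and is Lebesgue measure on a
(d-1)-dimensional Euclidean space. This also makes the restricted measure s-finite, as Fubini
requires. -/
theorem map_orthogonal_volume (hν : ‖ν‖ = 1) (c : ℝ) :
    Measure.map (fun w : (Submodule.span ℝ {ν})ᗮ => c • ν + (w : Space d)) volume =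
      (μHE[d - 1] : Measure (Space d)).restrict {x | inner ℝ ν x = c} := by
  have hν0 : ν ≠ 0 := by rintro rfl; simp at hν
  have hrank : Module.finrank ℝ (Submodule.span ℝ {ν})ᗮ = d - 1 := by
    have h := (Submodule.span ℝ {ν}).finrank_add_finrank_orthogonal
    rw [finrank_span_singleton hν0, finrank_euclideanSpace_fin] at h
    omega
  rw [← InnerProductSpace.euclideanHausdorffMeasure_eq_volume, hrank]
  have hiso : Isometry (fun w : (Submodule.span ℝ {ν})ᗮ => c • ν + (w : Space d)) :=
    Isometry.of_dist_eq fun x y => by simp [Subtype.dist_eq]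
  rw [hiso.map_euclideanHausdorffMeasure]
  congr 1
  ext x
  simp only [Set.mem_range, Set.mem_ofPred_eq]
  constructor
  · rintro ⟨w, rfl⟩
    have := Submodule.mem_orthogonal_singleton_iff_inner_right.1 w.2
    simp [inner_add_right, inner_smul_right, this, hν]
  · intro h
    refine ⟨⟨x - c • ν, ?_⟩, by simp⟩
    rw [Submodule.mem_orthogonal_singleton_iff_inner_right]
    simp [inner_sub_right, inner_smul_right, hν, h]

theorem measurePreserving_orthogonal_add_smul (hν : ‖ν‖ = 1) (c : ℝ) :
    MeasurePreserving (fun z : ℝ × (Submodule.span ℝ {ν})ᗮ => c • ν + (z.2 : Space d) + z.1 • ν)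
      (volume.prod volume) volume := by
  have h1 := ((Submodule.span ℝ {ν}).measurePreserving_measurableEquivProd (c • ν)).symm
  have h0 : (μHE[Module.finrank ℝ (Space d)] : Measure (Space d)) = volume :=
    InnerProductSpace.euclideanHausdorffMeasure_eq_volume
  rw [h0] at h1
  have h2 := (LinearIsometryEquiv.toSpanUnitSingleton ν hν).measurePreserving
  have h3 := h2.prod (MeasurePreserving.id (volume : Measure (Submodule.span ℝ {ν})ᗮ))
  convert! h1.comp h3 using 1
  ext1 z
  simp only [Function.comp, Prod.map, id, Submodule.measurableEquivProd_symm_apply,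
    LinearIsometryEquiv.toSpanUnitSingleton_apply, vadd_eq_add]
  abel

/-- Split e = aν + q with q orthogonal to ν. Passing from orthogonal to oblique coordinates scales t
by a, which gives the Jacobian |a|, and then shears by tq, which preserves the measure. -/
theorem measurePreserving_hyperplane_add_smul (hν : ‖ν‖ = 1) (he : inner ℝ ν e ≠ (0 : ℝ)) (c : ℝ) :
    MeasurePreserving (fun z : ℝ × Space d => z.2 + z.1 • e)
      (ENNReal.ofReal |inner ℝ ν e| •
        volume.prod ((μHE[d - 1] : Measure (Space d)).restrict {x | inner ℝ ν x = c})) volume := by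
  set a : ℝ := inner ℝ ν e
  refine ⟨by fun_prop, ?_⟩
  have hq : e - a • ν ∈ (Submodule.span ℝ {ν})ᗮ := by
    rw [Submodule.mem_orthogonal_singleton_iff_inner_right]
    simp [inner_sub_right, inner_smul_right, hν, a]
  let q : (Submodule.span ℝ {ν})ᗮ := ⟨e - a • ν, hq⟩
  have hscale : MeasurePreserving (fun t : ℝ => a * t) (ENNReal.ofReal |a| • volume) volume :=
    ⟨by fun_prop, by rw [Measure.map_smul]; exact Real.smul_map_volume_mul_left he⟩
  have hskew : MeasurePreserving (fun z : ℝ × (Submodule.span ℝ {ν})ᗮ => (a * z.1, z.2 + z.1 • q))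
      ((ENNReal.ofReal |a| • volume).prod volume) (volume.prod volume) :=
    hscale.skew_product (g := fun t w => w + t • q) (by unfold Function.uncurry; fun_prop)
      (Filter.Eventually.of_forall fun t => map_add_right_eq_self _ _)
  have hcomp := (measurePreserving_orthogonal_add_smul hν c).comp hskew
  have hg : Measurable (fun w : (Submodule.span ℝ {ν})ᗮ => c • ν + (w : Space d)) := by fun_prop
  rw [← map_orthogonal_volume hν c, ← Measure.map_id (μ := (volume : Measure ℝ)),
    Measure.map_prod_map _ _ measurable_id hg, Measure.map_smul, Measure.map_map (by fun_prop)
    (by fun_prop), ← hcomp.map_eq, Measure.prod_smul_left, Measure.map_smul]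
  congr 2
  ext1 z
  simp only [Function.comp, Prod.map, id, q, Submodule.coe_add, Submodule.coe_smul, mul_comm a]
  module

/-- The parameter at which the line through `y` in the direction `e` meets a hyperplane. -/
noncomputable def hitTime (ν : Space d) (c : ℝ) (e y : Space d) : ℝ :=
  (c - inner ℝ ν y) / inner ℝ ν e

@[fun_prop]
theorem continuous_hitTime : Continuous (hitTime ν c e) := by
  unfold hitTime
  fun_prop

theorem eq_hitTime (he : inner ℝ ν e ≠ (0 : ℝ)) {y : Space d} {t : ℝ}
    (h : inner ℝ ν (y + t • e) = c) : t = hitTime ν c e y := by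
  rw [inner_add_right, inner_smul_right] at h
  rw [hitTime, eq_div_iff he]
  linarith

theorem hitTime_add_smul (he : inner ℝ ν e ≠ (0 : ℝ)) {p : Space d} (hp : inner ℝ ν p = c) (t : ℝ) :
    hitTime ν c e (p + t • e) = -t := by
  rw [hitTime, inner_add_right, inner_smul_right, hp]
  field_simp
  ring

/-- A transversal line meets the hyperplane in exactly one point. In oblique coordinates that point
is the second coordinate, which avoids a null set almost surely. -/
theorem ae_forall_line_notMem (hν : ‖ν‖ = 1) (he : inner ℝ ν e ≠ (0 : ℝ)) {S : Set (Space d)}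
    (hS : μHE[d - 1] S = 0) :
    ∀ᵐ y : Space d, ∀ t : ℝ, inner ℝ ν (y + t • e) = c → y + t • e ∉ S := by
  set S' := toMeasurable (μHE[d - 1] : Measure (Space d)) S
  have hS' : μHE[d - 1] S' = 0 := by rw [measure_toMeasurable, hS]
  have hmeas : MeasurableSet S' := measurableSet_toMeasurable _ _
  have hmp := measurePreserving_hyperplane_add_smul hν he c
  have key : ∀ᵐ y : Space d, y + hitTime ν c e y • e ∉ S' := by
    rw [← hmp.map_eq, ae_map_iff hmp.measurable.aemeasurable]
    · refine Measure.ae_smul_measure ?_ _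
      have h1 : ∀ᵐ p ∂((μHE[d - 1] : Measure (Space d)).restrict {x | inner ℝ ν x = c}),
          p ∉ S' ∧ inner ℝ ν p = c := by
        have hplane : MeasurableSet {x : Space d | inner ℝ ν x = c} :=
          (isClosed_eq (by fun_prop) (by fun_prop)).measurableSet
        filter_upwards [ae_restrict_mem hplane,
          ae_restrict_of_ae (measure_eq_zero_iff_ae_notMem.1 hS')] with p h1 h2
        exact ⟨h2, h1⟩
      have hsf : SFinite ((μHE[d - 1] : Measure (Space d)).restrict {x | inner ℝ ν x = c}) := by
        rw [← map_orthogonal_volume hν c]; infer_instance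
      have h2 := Measure.quasiMeasurePreserving_snd (μ := (volume : Measure ℝ)) |>.ae h1
      filter_upwards [h2] with z hz
      rw [hitTime_add_smul he hz.2]
      simpa using hz.1
    · exact (measurableSet_preimage (f := fun y => y + hitTime ν c e y • e)
        (by fun_prop) hmeas).compl
  filter_upwards [key] with y hy t ht hmem
  rw [eq_hitTime he ht] at hmem
  exact hy (subset_toMeasurable _ _ hmem)

variable {V : Type*} [NormedAddCommGroup V] [NormedSpace ℝ V] [CompleteSpace V]

/-- The domain consists of the points from which motion in the direction e reaches F at a positive
time. On the half-line ending at p in F the derivative integrates to f(p), by compact support; the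
Jacobian supplies the factor. -/
theorem setIntegral_shadow (hν : ‖ν‖ = 1) (he : inner ℝ ν e ≠ (0 : ℝ)) {F : Set (Space d)}
    (hF : MeasurableSet F) (hFc : ∀ x ∈ F, inner ℝ ν x = c) {f : Space d → V}
    (hf : ContDiff ℝ 1 f) (hfs : HasCompactSupport f) :
    ∫ y in {y | y + hitTime ν c e y • e ∈ F ∧ 0 < hitTime ν c e y}, fderiv ℝ f y e =
      |inner ℝ ν e| • ∫ x in F, f x ∂μHE[d - 1] := by
  have hmp := measurePreserving_hyperplane_add_smul hν he c
  have hsf : SFinite ((μHE[d - 1] : Measure (Space d)).restrict {x | inner ℝ ν x = c}) := by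
    rw [← map_orthogonal_volume hν c]; infer_instance
  have hplane : MeasurableSet {x : Space d | inner ℝ ν x = c} :=
    (isClosed_eq (by fun_prop) (by fun_prop)).measurableSet
  set ρ := (μHE[d - 1] : Measure (Space d)).restrict {x | inner ℝ ν x = c} with hρ
  set D : Set (Space d) := {y | y + hitTime ν c e y • e ∈ F ∧ 0 < hitTime ν c e y}
  have hmemD : ∀ p, inner ℝ ν p = c → ∀ t : ℝ, p + t • e ∈ D ↔ p ∈ F ∧ t < 0 := by
    intro p hp t
    have h : p + t • e ∈ D ↔ p + t • e + hitTime ν c e (p + t • e) • e ∈ F ∧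
      0 < hitTime ν c e (p + t • e) := Iff.rfl
    rw [h, hitTime_add_smul he hp]
    simp
  have hDm : MeasurableSet D :=
    (measurableSet_preimage (f := fun y => y + hitTime ν c e y • e) (by fun_prop) hF).inter
      (isOpen_lt continuous_const continuous_hitTime).measurableSet
  have hcont : Continuous (fun y => fderiv ℝ f y e) := by
    have := hf.continuous_fderiv one_ne_zero
    fun_prop
  have hsupp : HasCompactSupport (fun y => fderiv ℝ f y e) := by
    refine (hfs.fderiv ℝ).comp_left (g := fun L : Space d →L[ℝ] V => L e) ?_
    simp
  have hint : Integrable (fun y => fderiv ℝ f y e) := hcont.integrable_of_hasCompactSupport hsupp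
  have ha : (0 : ℝ) ≤ |inner ℝ ν e| := abs_nonneg _
  have hline : ∀ p : Space d, ∫ t in Set.Iio (0 : ℝ), fderiv ℝ f (p + t • e) e = f p := by
    intro p
    have he0 : e ≠ 0 := by rintro rfl; simp at he
    have hemb : Topology.IsClosedEmbedding (fun t : ℝ => p + t • e) :=
      (Homeomorph.addLeft p).isClosedEmbedding.comp (isClosedEmbedding_smul_left he0)
    have h1 : ContDiff ℝ 1 (fun t : ℝ => f (p + t • e)) := hf.comp (by fun_prop)
    have h2 : HasCompactSupport (fun t : ℝ => f (p + t • e)) := hfs.comp_isClosedEmbedding hemb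
    have h3 := h2.integral_Iic_deriv_eq h1 0
    rw [zero_smul, add_zero] at h3
    rw [← integral_Iic_eq_integral_Iio, ← h3]
    congr 1
    ext1 t
    have h4 : HasDerivAt (fun t : ℝ => p + t • e) e t := by
      simpa using ((hasDerivAt_id t).smul_const e).const_add p
    exact ((((hf.differentiable one_ne_zero) _).hasFDerivAt.comp_hasDerivAt t h4).deriv).symm
  have hInd : Integrable (D.indicator (fun y => fderiv ℝ f y e))
      (Measure.map (fun z : ℝ × Space d => z.2 + z.1 • e)
        (ENNReal.ofReal |inner ℝ ν e| • volume.prod ρ)) := by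
    rw [hmp.map_eq]; exact hint.indicator hDm
  have hne : ENNReal.ofReal |inner ℝ ν e| ≠ 0 := by simpa using he
  have hInd2 := (integrable_smul_measure hne ENNReal.ofReal_ne_top).1
    (hInd.comp_measurable hmp.measurable)
  simp only [Function.comp_def] at hInd2
  rw [← integral_indicator hDm, ← hmp.map_eq, integral_map hmp.measurable.aemeasurable
    hInd.aestronglyMeasurable, integral_smul_measure, ENNReal.toReal_ofReal ha]
  congr 1
  rw [integral_prod_symm _ hInd2]
  have hFF : (μHE[d - 1] : Measure (Space d)).restrict F = ρ.restrict F := by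
    rw [hρ, Measure.restrict_restrict hF]
    congr 1
    ext x; simpa using hFc x
  rw [hFF, ← integral_indicator hF]
  refine integral_congr_ae ?_
  filter_upwards [ae_restrict_mem hplane] with p hp
  by_cases hpF : p ∈ F
  · rw [Set.indicator_of_mem hpF, ← hline p, ← integral_indicator measurableSet_Iio]
    congr 1
    ext1 t
    simp [Set.indicator, hmemD p hp, hpF]
  · rw [Set.indicator_of_notMem hpF]
    refine integral_eq_zero_of_ae (Filter.Eventually.of_forall fun t => ?_)
    simp [Set.indicator, hmemD p hp, hpF]

end Hyperplane

/-! ### The indicator of a polytope along a transversal line. -/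

section Line

variable {d : ℕ} {κ : Type*} {K : Set (Space d)} {N : Finset κ} {F : κ → Set (Space d)}
  {ν : κ → Space d} {c : κ → ℝ} {e y : Space d}

/-- `x` is a regular boundary point of `K` with the outward normal `ν`. -/
def IsOutwardNormal (K : Set (Space d)) (x ν : Space d) : Prop :=
  ∃ ε > 0, ∀ y ∈ Metric.ball x ε,
    (0 < inner ℝ ν (y - x) → y ∉ K) ∧ (inner ℝ ν (y - x) < 0 → y ∈ K)

open Classical in
/-- The indicator function of `K` with the value `1 / 2` on the boundary. -/
noncomputable def halfIndicator (K : Set (Space d)) (x : Space d) : ℝ :=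
  if x ∈ interior K then 1 else if x ∈ frontier K then 1 / 2 else 0

/-- The Heaviside function with the value `1 / 2` at zero. -/
noncomputable def heaviside (t : ℝ) : ℝ := (1 + (SignType.sign t : ℝ)) / 2

theorem heaviside_of_pos {t : ℝ} (h : 0 < t) : heaviside t = 1 := by
  simp [heaviside, sign_pos h]

theorem heaviside_of_neg {t : ℝ} (h : t < 0) : heaviside t = 0 := by
  simp [heaviside, sign_neg h]

theorem heaviside_zero : heaviside 0 = 1 / 2 := by
  simp [heaviside]

theorem eventually_heaviside_sub_eq {a s : ℝ} (h : a ≠ s) :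
    ∀ᶠ t in nhds s, heaviside (a - t) = heaviside (a - s) := by
  rcases lt_or_gt_of_ne h with h | h
  · filter_upwards [lt_mem_nhds h] with t ht
    rw [heaviside_of_neg (by linarith), heaviside_of_neg (by linarith)]
  · filter_upwards [gt_mem_nhds h] with t ht
    rw [heaviside_of_pos (by linarith), heaviside_of_pos (by linarith)]

theorem halfIndicator_of_notMem (hK : IsClosed K) {x : Space d} (hx : x ∉ K) :
    halfIndicator K x = 0 := by
  rw [halfIndicator, if_neg fun h => hx (interior_subset h),
    if_neg fun h => hx (hK.frontier_subset h)]

theorem halfIndicator_of_mem_interior {x : Space d} (hx : x ∈ interior K) :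
    halfIndicator K x = 1 := if_pos hx

theorem halfIndicator_of_mem_frontier {x : Space d} (hx : x ∈ frontier K) :
    halfIndicator K x = 1 / 2 := by
  rw [halfIndicator, if_neg hx.2, if_pos hx]

theorem eventually_halfIndicator_eq (hK : IsClosed K) {x : Space d} (hx : x ∉ frontier K) :
    ∀ᶠ z in nhds x, halfIndicator K z = halfIndicator K x := by
  by_cases h : x ∈ K
  · have h' : x ∈ interior K := by
      by_contra h'
      exact hx ⟨subset_closure h, h'⟩
    filter_upwards [isOpen_interior.mem_nhds h'] with z hz
    rw [halfIndicator_of_mem_interior hz, halfIndicator_of_mem_interior h']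
  · filter_upwards [hK.isOpen_compl.mem_nhds h] with z hz
    rw [halfIndicator_of_notMem hK hz, halfIndicator_of_notMem hK h]

theorem IsOutwardNormal.eventually_halfIndicator (hK : IsClosed K) {x n : Space d}
    (hn : IsOutwardNormal K x n) :
    ∀ᶠ z in nhds x, inner ℝ n (z - x) ≠ (0 : ℝ) →
      halfIndicator K z = heaviside (-inner ℝ n (z - x)) := by
  obtain ⟨ε, hε, h⟩ := hn
  filter_upwards [Metric.ball_mem_nhds x hε] with z hz hz0
  rcases lt_or_gt_of_ne hz0 with h0 | h0
  · rw [heaviside_of_pos (by linarith), halfIndicator_of_mem_interior]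
    have hopen : IsOpen (Metric.ball x ε ∩ {z | inner ℝ n (z - x) < 0}) :=
      Metric.isOpen_ball.inter (isOpen_lt (by fun_prop) continuous_const)
    exact interior_maximal (fun w hw => (h w hw.1).2 hw.2) hopen ⟨hz, h0⟩
  · rw [heaviside_of_neg (by linarith), halfIndicator_of_notMem hK ((h z hz).1 h0)]

open Classical in
-- Move the base point along the line. Both sides change only where the line crosses a face, and
-- there by the same jump: the line leaves K if the outward normal satisfies ν·e > 0 and enters K if
-- ν·e < 0. Both sides vanish far along the line.
theorem halfIndicator_eq_sum_heaviside (hK : IsCompact K)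
    (hFc : ∀ k ∈ N, ∀ x ∈ F k, inner ℝ (ν k) x = c k)
    (hFfr : ∀ k ∈ N, F k ⊆ frontier K)
    (hloc : ∀ k ∈ N, ∀ x ∈ F k, IsOutwardNormal K x (ν k))
    (hdisj : ∀ k ∈ N, ∀ l ∈ N, k ≠ l → Disjoint (F k) (F l))
    (he : ∀ k ∈ N, inner ℝ (ν k) e ≠ (0 : ℝ)) (he0 : e ≠ 0)
    (hy : ∀ t : ℝ, y + t • e ∈ frontier K → ∃ k ∈ N, y + t • e ∈ F k) :
    halfIndicator K y = ∑ k ∈ N, (SignType.sign (inner ℝ (ν k) e : ℝ) : ℝ) *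
      (if y + hitTime (ν k) (c k) e y • e ∈ F k then heaviside (hitTime (ν k) (c k) e y)
        else 0) := by
  set τ : κ → ℝ := fun k => hitTime (ν k) (c k) e y
  set G : κ → ℝ → ℝ := fun k s => (SignType.sign (inner ℝ (ν k) e : ℝ) : ℝ) *
      (if y + τ k • e ∈ F k then heaviside (τ k - s) else 0) with hG
  set X : ℝ → ℝ := fun s => halfIndicator K (y + s • e) - ∑ k ∈ N, G k s with hX
  have hcontl : Continuous (fun s : ℝ => y + s • e) := by fun_prop
  have hGconst : ∀ k s, (y + τ k • e ∈ F k → τ k ≠ s) → ∀ᶠ t in nhds s, G k t = G k s := by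
    intro k s h
    by_cases hk : y + τ k • e ∈ F k
    · filter_upwards [eventually_heaviside_sub_eq (h hk)] with t ht
      simp only [hG, ht]
    · exact Filter.Eventually.of_forall fun t => by simp only [hG, if_neg hk]
  -- At the crossing parameter itself both terms take the mean of their one-sided limits. The
  -- conventions with value 1/2 thus make the difference locally constant everywhere, so constant on
  -- the connected line.
  have hlc : IsLocallyConstant X := by
    rw [IsLocallyConstant.iff_eventually_eq]
    intro s
    by_cases hs : y + s • e ∈ frontier K
    · obtain ⟨k, hk, hkF⟩ := hy s hs
      have hks : s = τ k := eq_hitTime (he k hk) (hFc k hk _ hkF)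
      have hother : ∀ᶠ t in nhds s, ∀ l ∈ N.erase k, G l t = G l s := by
        rw [Filter.eventually_all_finset]
        intro l hl
        refine hGconst l s fun hlF hls => ?_
        rw [hls] at hlF
        exact Set.disjoint_left.1 (hdisj l (Finset.mem_of_mem_erase hl) k hk
          (Finset.ne_of_mem_erase hl)) hlF hkF
      have hself := hcontl.continuousAt.eventually
        ((hloc k hk _ hkF).eventually_halfIndicator hK.isClosed)
      filter_upwards [hother, hself] with t ht1 ht2
      simp only [hX]
      rw [← Finset.add_sum_erase N (fun k => G k t) hk,
        ← Finset.add_sum_erase N (fun k => G k s) hk, Finset.sum_congr rfl ht1]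
      suffices halfIndicator K (y + t • e) - G k t = halfIndicator K (y + s • e) - G k s by
        linarith
      by_cases hts : t = s
      · rw [hts]
      have hinner : (inner ℝ (ν k) (y + t • e - (y + s • e)) : ℝ) = (t - s) * inner ℝ (ν k) e := by
        rw [show y + t • e - (y + s • e) = (t - s) • e by module, inner_smul_right]
      rw [hinner] at ht2
      rw [ht2 (mul_ne_zero (sub_ne_zero.2 hts) (he k hk)), halfIndicator_of_mem_frontier hs]
      simp only [hG, ← hks, if_pos hkF, sub_self, heaviside_zero]
      rcases lt_or_gt_of_ne (he k hk) with ha | ha <;> rcases lt_or_gt_of_ne hts with hlt | hlt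
      · rw [sign_neg ha, heaviside_of_pos (sub_pos.2 hlt), heaviside_of_neg (by nlinarith)]
        norm_num
      · rw [sign_neg ha, heaviside_of_neg (sub_neg.2 hlt), heaviside_of_pos (by nlinarith)]
        norm_num
      · rw [sign_pos ha, heaviside_of_pos (sub_pos.2 hlt), heaviside_of_pos (by nlinarith)]
        norm_num
      · rw [sign_pos ha, heaviside_of_neg (sub_neg.2 hlt), heaviside_of_neg (by nlinarith)]
        norm_num
    · have hall : ∀ᶠ t in nhds s, ∀ l ∈ N, G l t = G l s := by
        rw [Filter.eventually_all_finset]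
        intro l hl
        refine hGconst l s fun hlF hls => hs ?_
        rw [hls] at hlF
        exact hFfr l hl hlF
      filter_upwards [hall, hcontl.continuousAt.eventually
        (eventually_halfIndicator_eq hK.isClosed hs)] with t h1 h2
      simp only [hX, h2, Finset.sum_congr rfl h1]
  -- Beyond the bounded set K and all the hitting times, every term is zero.
  obtain ⟨s, hsK, hsτ⟩ : ∃ s : ℝ, y + s • e ∉ K ∧ ∀ k ∈ N, τ k < s := by
    obtain ⟨R, hR⟩ := hK.isBounded.exists_norm_le
    have h1 : ∀ᶠ s : ℝ in Filter.atTop, ∀ k ∈ N, τ k < s := by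
      rw [Filter.eventually_all_finset]
      exact fun k _ => Filter.eventually_gt_atTop _
    obtain ⟨s, hs1, hs2, hs3⟩ := (h1.and ((Filter.eventually_gt_atTop ((R + ‖y‖) / ‖e‖)).and
      (Filter.eventually_ge_atTop 0))).exists
    refine ⟨s, fun hmem => ?_, hs1⟩
    have h2 := hR _ hmem
    rw [div_lt_iff₀ (norm_pos_iff.2 he0)] at hs2
    have h3 : ‖s • e‖ ≤ ‖y + s • e‖ + ‖y‖ := by
      simpa using norm_sub_le (y + s • e) y
    rw [norm_smul, Real.norm_of_nonneg hs3] at h3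
    linarith
  have h0 : X 0 = X s := hlc.apply_eq_of_preconnectedSpace 0 s
  have hXs : X s = 0 := by
    simp only [hX, halfIndicator_of_notMem hK.isClosed hsK, zero_sub, neg_eq_zero]
    refine Finset.sum_eq_zero fun k hk => ?_
    simp only [hG, heaviside_of_neg (sub_neg.2 (hsτ k hk)), ite_self, mul_zero]
  rw [hXs] at h0
  simp only [hX, hG, zero_smul, add_zero, sub_zero] at h0
  exact sub_eq_zero.1 h0

end Line

/-! ### The divergence theorem for polytopes. -/

section Divergence

variable {d : ℕ} {V : Type*} [NormedAddCommGroup V] [NormedSpace ℝ V]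

theorem dense_inner_ne_zero {h : Space d} (hh : h ≠ 0) : Dense {e : Space d | inner ℝ h e ≠ (0 : ℝ)} := by
  intro e
  by_cases he : inner ℝ h e = (0 : ℝ)
  · have h1 : Filter.Tendsto (fun t : ℝ => e + t • h) (nhdsWithin 0 {0}ᶜ) (nhds e) := by
      have : Continuous fun t : ℝ => e + t • h := by fun_prop
      simpa using (this.tendsto 0).mono_left nhdsWithin_le_nhds
    refine mem_closure_of_tendsto h1 ?_
    filter_upwards [self_mem_nhdsWithin] with t ht
    simp only [inner_add_right, he, inner_smul_right, zero_add]
    exact mul_ne_zero ht (inner_self_ne_zero.2 hh)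
  · exact subset_closure he

theorem dense_forall_inner_ne_zero (H : Finset (Space d)) (hH : ∀ h ∈ H, h ≠ 0) :
    Dense {e : Space d | ∀ h ∈ H, inner ℝ h e ≠ (0 : ℝ)} := by
  have h1 : {e : Space d | ∀ h ∈ H, inner ℝ h e ≠ (0 : ℝ)} =
      ⋂ h ∈ (H : Set (Space d)), {e : Space d | inner ℝ h e ≠ (0 : ℝ)} := by
    ext e; simp
  rw [h1]
  exact dense_biInter_of_isOpen
    (fun h _ => isOpen_ne_fun (by fun_prop) continuous_const) H.countable_toSet
    (fun h hh => dense_inner_ne_zero (hH h hh))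

theorem ae_inner_ne {h : Space d} (hh : h ≠ 0) (c : ℝ) : ∀ᵐ y : Space d, inner ℝ h y ≠ c := by
  have hν : ‖‖h‖⁻¹ • h‖ = 1 := norm_smul_inv_norm hh
  have hpos : 0 < ‖h‖ := norm_pos_iff.2 hh
  have hmp := measurePreserving_hyperplane_add_smul (e := ‖h‖⁻¹ • h) hν
    (by rw [real_inner_self_eq_norm_sq, hν]; norm_num) 0
  have hsf : SFinite ((μHE[d - 1] : Measure (Space d)).restrict
      {x | inner ℝ (‖h‖⁻¹ • h) x = (0 : ℝ)}) := by
    rw [← map_orthogonal_volume hν]; infer_instance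
  have hplane : MeasurableSet {x : Space d | inner ℝ (‖h‖⁻¹ • h) x = (0 : ℝ)} :=
    (isClosed_eq (by fun_prop) (by fun_prop)).measurableSet
  rw [← hmp.map_eq, ae_map_iff hmp.measurable.aemeasurable]
  · refine Measure.ae_smul_measure ?_ _
    have h1 := Measure.quasiMeasurePreserving_fst (μ := (volume : Measure ℝ)) (ν := (μHE[d - 1] : Measure (Space d)).restrict
      {x | inner ℝ (‖h‖⁻¹ • h) x = (0 : ℝ)}) |>.ae
      (Measure.ae_ne volume (c / ‖h‖))
    have h2 := Measure.quasiMeasurePreserving_snd (μ := (volume : Measure ℝ)) |>.ae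
      (ae_restrict_mem (μ := (μHE[d - 1] : Measure (Space d))) hplane)
    filter_upwards [h1, h2] with z hz1 hz2 hz3
    refine hz1 ?_
    have h3 : inner ℝ h z.2 = (0 : ℝ) := by
      have h4 : inner ℝ (‖h‖⁻¹ • h) z.2 = (0 : ℝ) := hz2
      rw [real_inner_smul_left] at h4
      exact (mul_eq_zero.1 h4).resolve_left (by positivity)
    rw [inner_add_right, inner_smul_right, inner_smul_right, h3, real_inner_self_eq_norm_sq] at hz3
    rw [← hz3]
    field_simp
    ring
  · exact (isOpen_ne_fun (by fun_prop) continuous_const).measurableSet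

variable [CompleteSpace V]
  {κ : Type*} {K : Set (Space d)} {N : Finset κ} {F : κ → Set (Space d)}
  {ν : κ → Space d} {c : κ → ℝ}

/-- Integrates the shadow decomposition of the indicator. The sign of ν·e comes from the
decomposition and |ν·e| from each shadow; their product is ν·e. -/
theorem setIntegral_fderiv_eq_sum_of_transversal (hK : IsCompact K) {H : Finset (Space d × ℝ)}
    (hH : ∀ x ∈ frontier K, ∃ h ∈ H, inner ℝ h.1 x = h.2)
    (hν : ∀ k ∈ N, ‖ν k‖ = 1) (hFm : ∀ k ∈ N, MeasurableSet (F k))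
    (hFc : ∀ k ∈ N, ∀ x ∈ F k, inner ℝ (ν k) x = c k) (hFfr : ∀ k ∈ N, F k ⊆ frontier K)
    (hloc : ∀ k ∈ N, ∀ x ∈ F k, IsOutwardNormal K x (ν k))
    (hdisj : ∀ k ∈ N, ∀ l ∈ N, k ≠ l → Disjoint (F k) (F l))
    (hcov : μHE[d - 1] (frontier K \ ⋃ k ∈ N, F k) = 0) {f : Space d → V} (hf : ContDiff ℝ 1 f)
    (hfs : HasCompactSupport f) {e : Space d} (heH : ∀ h ∈ H, inner ℝ h.1 e ≠ (0 : ℝ))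
    (heν : ∀ k ∈ N, inner ℝ (ν k) e ≠ (0 : ℝ)) (he0 : e ≠ 0) :
    ∫ x in K, fderiv ℝ f x e =
      ∑ k ∈ N, (inner ℝ (ν k) e : ℝ) • ∫ x in F k, f x ∂μHE[d - 1] := by
  classical
  have hcont : Continuous (fun y => fderiv ℝ f y e) := by
    have := hf.continuous_fderiv one_ne_zero
    fun_prop
  have hsupp : HasCompactSupport (fun y => fderiv ℝ f y e) := by
    refine (hfs.fderiv ℝ).comp_left (g := fun L : Space d →L[ℝ] V => L e) ?_
    simp
  have hint : Integrable (fun y => fderiv ℝ f y e) := hcont.integrable_of_hasCompactSupport hsupp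
  set D : κ → Set (Space d) := fun k => {y | y + hitTime (ν k) (c k) e y • e ∈ F k ∧
    0 < hitTime (ν k) (c k) e y} with hD
  have hDm : ∀ k ∈ N, MeasurableSet (D k) := fun k hk =>
    (measurableSet_preimage (f := fun y => y + hitTime (ν k) (c k) e y • e)
      (by fun_prop) (hFm k hk)).inter (isOpen_lt continuous_const continuous_hitTime).measurableSet
  have hHne : ∀ h ∈ H, h.1 ≠ 0 := by
    intro h hh h0
    exact heH h hh (by rw [h0, inner_zero_left])
  -- The uncovered part of the boundary is null and lies in finitely many hyperplanes, all
  -- transversal to e, so almost every line misses it.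
  have hline : ∀ᵐ y : Space d, ∀ t : ℝ, y + t • e ∈ frontier K → ∃ k ∈ N, y + t • e ∈ F k := by
    have h1 : ∀ᵐ y : Space d, ∀ h ∈ H, ∀ t : ℝ, inner ℝ (‖h.1‖⁻¹ • h.1) (y + t • e) = ‖h.1‖⁻¹ * h.2 →
        y + t • e ∉ frontier K \ ⋃ k ∈ N, F k := by
      rw [Filter.eventually_all_finset]
      intro h hh
      refine ae_forall_line_notMem (norm_smul_inv_norm (hHne h hh)) ?_ hcov
      rw [real_inner_smul_left]
      exact mul_ne_zero (inv_ne_zero (norm_ne_zero_iff.2 (hHne h hh))) (heH h hh)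
    filter_upwards [h1] with y hy t ht
    obtain ⟨h, hh, hxh⟩ := hH _ ht
    have h2 := hy h hh t (by rw [real_inner_smul_left, hxh])
    by_contra hcon
    refine h2 ⟨ht, ?_⟩
    simpa using hcon
  have hfr : ∀ᵐ y : Space d, y ∉ frontier K := by
    have h1 : ∀ᵐ y : Space d, ∀ h ∈ H, inner ℝ h.1 y ≠ h.2 := by
      rw [Filter.eventually_all_finset]
      exact fun h hh => ae_inner_ne (hHne h hh) _
    filter_upwards [h1] with y hy hmem
    obtain ⟨h, hh, hxh⟩ := hH _ hmem
    exact hy h hh hxh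
  have hind : ∀ᵐ y : Space d, K.indicator (fun y => fderiv ℝ f y e) y =
      ∑ k ∈ N, (SignType.sign (inner ℝ (ν k) e : ℝ) : ℝ) •
        (D k).indicator (fun y => fderiv ℝ f y e) y := by
    filter_upwards [hline, hfr] with y hy1 hy2
    have h1 := halfIndicator_eq_sum_heaviside hK hFc hFfr hloc hdisj heν he0 hy1
    have h2 : K.indicator (fun y => fderiv ℝ f y e) y = halfIndicator K y • fderiv ℝ f y e := by
      by_cases hyK : y ∈ K
      · have hyi : y ∈ interior K := by
          by_contra hyi
          exact hy2 ⟨subset_closure hyK, hyi⟩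
        rw [halfIndicator_of_mem_interior hyi, one_smul, Set.indicator_of_mem hyK]
      · rw [halfIndicator_of_notMem hK.isClosed hyK, zero_smul, Set.indicator_of_notMem hyK]
    rw [h2, h1, Finset.sum_smul]
    refine Finset.sum_congr rfl fun k hk => ?_
    rw [mul_smul]
    congr 1
    by_cases hyF : y + hitTime (ν k) (c k) e y • e ∈ F k
    · rw [if_pos hyF]
      rcases lt_trichotomy 0 (hitTime (ν k) (c k) e y) with h0 | h0 | h0
      · rw [heaviside_of_pos h0, one_smul, Set.indicator_of_mem]
        exact ⟨hyF, h0⟩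
      -- Hitting time zero would put y itself on the boundary, which is excluded almost everywhere.
      · rw [← h0, zero_smul, add_zero] at hyF
        exact absurd (hFfr k hk hyF) hy2
      · rw [heaviside_of_neg h0, zero_smul, Set.indicator_of_notMem]
        exact fun h => h0.not_gt h.2
    · rw [if_neg hyF, zero_smul, Set.indicator_of_notMem]
      exact fun h => hyF h.1
  rw [← integral_indicator hK.measurableSet, integral_congr_ae hind, integral_finsetSum]
  · refine Finset.sum_congr rfl fun k hk => ?_
    rw [integral_smul, integral_indicator (hDm k hk),
      setIntegral_shadow (hν k hk) (heν k hk) (hFm k hk) (hFc k hk) hf hfs, smul_smul,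
      sign_mul_abs]
  · exact fun k hk => (hint.indicator (hDm k hk)).smul _

/-- The divergence theorem for a polytope: the faces `F k` with the outward normals `ν k` cover
the boundary up to a null set. -/
theorem IsPolytope.setIntegral_fderiv_eq_sum (hd : 1 ≤ d) (hK : IsPolytope K)
    (hν : ∀ k ∈ N, ‖ν k‖ = 1) (hFm : ∀ k ∈ N, MeasurableSet (F k))
    (hFc : ∀ k ∈ N, ∀ x ∈ F k, inner ℝ (ν k) x = c k) (hFfr : ∀ k ∈ N, F k ⊆ frontier K)
    (hloc : ∀ k ∈ N, ∀ x ∈ F k, IsOutwardNormal K x (ν k))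
    (hdisj : ∀ k ∈ N, ∀ l ∈ N, k ≠ l → Disjoint (F k) (F l))
    (hcov : μHE[d - 1] (frontier K \ ⋃ k ∈ N, F k) = 0) {f : Space d → V} (hf : ContDiff ℝ 1 f)
    (e : Space d) :
    ∫ x in K, fderiv ℝ f x e =
      ∑ k ∈ N, (inner ℝ (ν k) e : ℝ) • ∫ x in F k, f x ∂μHE[d - 1] := by
  classical
  have hKc := hK.isCompact
  -- Multiplication by a bump function equal to 1 near K changes neither side.
  wlog hfs : HasCompactSupport f generalizing f with hwlog
  · obtain ⟨R, hR0, hR⟩ := hKc.isBounded.exists_pos_norm_lt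
    let χ : ContDiffBump (0 : Space d) := ⟨R, R + 1, hR0, by linarith⟩
    have hg : ContDiff ℝ 1 (fun x => χ x • f x) := χ.contDiff.smul hf
    have hgs : HasCompactSupport (fun x => χ x • f x) := χ.hasCompactSupport.smul_right
    have hχ : ∀ x ∈ K, (fun x => χ x • f x) =ᶠ[nhds x] f := by
      intro x hx
      have hx' : x ∈ Metric.ball (0 : Space d) χ.rIn := by simpa [χ] using hR x hx
      filter_upwards [χ.eventuallyEq_one_of_mem_ball hx'] with z hz
      simp [hz]
    have h1 : ∫ x in K, fderiv ℝ (fun x => χ x • f x) x e = ∫ x in K, fderiv ℝ f x e :=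
      setIntegral_congr_fun hKc.measurableSet fun x hx => by
        simp only [(hχ x hx).fderiv_eq]
    rw [← h1, hwlog hg hgs]
    refine Finset.sum_congr rfl fun k hk => ?_
    congr 1
    exact setIntegral_congr_fun (hFm k hk) fun x hx =>
      (hχ x (hKc.isClosed.frontier_subset (hFfr k hk hx))).eq_of_nhds
  obtain ⟨H, hH0, hH⟩ := hK.frontier_subset
  have hfd : Continuous (fderiv ℝ f) := hf.continuous_fderiv one_ne_zero
  -- Both sides are continuous in e, so it is enough to treat the dense set of directions
  -- transversal to all the hyperplanes.
  have hcl : IsClosed {e : Space d | ∫ x in K, fderiv ℝ f x e =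
      ∑ k ∈ N, (inner ℝ (ν k) e : ℝ) • ∫ x in F k, f x ∂μHE[d - 1]} := by
    refine isClosed_eq ?_ (by fun_prop)
    have h1 : ∀ e, ∫ x in K, fderiv ℝ f x e = (∫ x in K, fderiv ℝ f x) e := fun e =>
      (ContinuousLinearMap.integral_apply
        (hfd.continuousOn.integrableOn_compact hKc) e).symm
    simp_rw [h1]
    fun_prop
  -- The basis vector is added only to force the generic direction to be nonzero, even if there are
  -- no faces; it exists because 1 ≤ d.
  have hdense := dense_forall_inner_ne_zero
    (insert (EuclideanSpace.single ⟨0, hd⟩ 1) (H.image Prod.fst ∪ N.image ν)) (by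
      intro h hh
      simp only [Finset.mem_insert, Finset.mem_union, Finset.mem_image] at hh
      rcases hh with rfl | ⟨h, hh, rfl⟩ | ⟨k, hk, rfl⟩
      · simp
      · exact hH0 h hh
      · intro h0
        simpa [h0] using hν k hk)
  refine hcl.closure_subset_iff.2 ?_ (hdense e)
  intro e' he'
  replace he' : ∀ h ∈ insert (EuclideanSpace.single ⟨0, hd⟩ 1) (H.image Prod.fst ∪ N.image ν),
    inner ℝ h e' ≠ (0 : ℝ) := he'
  simp only [Finset.mem_insert, Finset.mem_union, Finset.mem_image] at he'
  refine setIntegral_fderiv_eq_sum_of_transversal hKc hH hν hFm hFc hFfr hloc hdisj hcov hf hfs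
    (fun h hh => he' _ (Or.inr (Or.inl ⟨h, hh, rfl⟩)))
    (fun k hk => he' _ (Or.inr (Or.inr ⟨k, hk, rfl⟩))) ?_
  rintro rfl
  exact he' _ (Or.inl rfl) (inner_zero_right _)

end Divergence

/-! ### Uniqueness of the outward normal. -/

section Normal

variable {d : ℕ} {K L : Set (Space d)} {x n n' : Space d}

theorem eventually_add_smul_mem_ball (x v : Space d) {ε : ℝ} (hε : 0 < ε) :
    ∀ᶠ t in nhdsWithin (0 : ℝ) (Set.Ioi 0), x + t • v ∈ Metric.ball x ε := by
  have h : Continuous fun t : ℝ => x + t • v := by fun_prop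
  have h1 := (h.tendsto 0).mono_left (nhdsWithin_le_nhds (s := Set.Ioi (0 : ℝ)))
  rw [zero_smul, add_zero] at h1
  exact h1 (Metric.ball_mem_nhds x hε)

/-- If n and n' differ, a small step from x along n - n' leaves K according to n and enters K
according to n'. -/
theorem IsOutwardNormal.eq (hn : ‖n‖ = 1) (hn' : ‖n'‖ = 1) (h : IsOutwardNormal K x n)
    (h' : IsOutwardNormal K x n') : n = n' := by
  by_contra hne
  obtain ⟨ε, hε, h⟩ := h
  obtain ⟨ε', hε', h'⟩ := h'
  have hlt : inner ℝ n n' < (1 : ℝ) := inner_lt_one_iff_real_of_norm_eq_one hn hn' |>.2 hne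
  obtain ⟨t, ht1, ht2, ht0⟩ := ((eventually_add_smul_mem_ball x (n - n') hε).and
    ((eventually_add_smul_mem_ball x (n - n') hε').and self_mem_nhdsWithin)).exists
  have ht0 : 0 < t := ht0
  refine (h _ ht1).1 ?_ ((h' _ ht2).2 ?_)
  · rw [add_sub_cancel_left, inner_smul_right, inner_sub_right, real_inner_self_eq_norm_sq, hn]
    exact mul_pos ht0 (by linarith)
  · rw [add_sub_cancel_left, inner_smul_right, inner_sub_right, real_inner_self_eq_norm_sq, hn',
      real_inner_comm]
    exact mul_neg_of_pos_of_neg ht0 (by linarith)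

end Normal

/-! ### Faces of mesh elements and the divergence theorem on an element. -/

namespace PeriodicMesh

variable {d : ℕ} {B : Type*} (T : PeriodicMesh d B) {j k l : T.Elem} {x ν : Space d}

theorem isClosed_cell (j : T.Elem) : IsClosed (T.cell j) := (T.isPolytope j).isCompact.isClosed

theorem isCompact_face (j k : T.Elem) : IsCompact (T.face j k) :=
  ((T.isPolytope j).isCompact.of_isClosed_subset isClosed_frontier
    (T.isClosed_cell j).frontier_subset).inter_right isClosed_frontier

theorem measurableSet_face (j k : T.Elem) : MeasurableSet (T.face j k) :=
  (T.isCompact_face j k).isClosed.measurableSet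

theorem cell_eq_image (w : Fin d → ℤ) (b : B) :
    T.cell (w, b) = (fun x => intVec w + x) '' T.cell (0, b) := by
  rw [← T.cell_shift w 0 b, add_zero]

theorem locallyFinite_cell [Finite B] : LocallyFinite T.cell := by
  intro x
  refine ⟨Metric.ball x 1, Metric.ball_mem_nhds x one_pos, ?_⟩
  have hb : ∀ b : B, ∃ R : ℝ, ∀ x ∈ T.cell (0, b), ‖x‖ ≤ R := fun b =>
    (T.isPolytope (0, b)).isCompact.isBounded.exists_norm_le
  choose R hR using hb
  obtain ⟨M, hM⟩ : ∃ M, ∀ b, R b ≤ M := by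
    obtain ⟨M, hM⟩ := (Set.finite_range R).bddAbove
    exact ⟨M, fun b => hM ⟨b, rfl⟩⟩
  set Q := M + (‖x‖ + 1)
  have hfin : (Set.pi Set.univ (fun _ : Fin d => Set.Icc (-⌈Q⌉) ⌈Q⌉)).Finite :=
    Set.Finite.pi fun _ => Set.finite_Icc _ _
  refine ((hfin.prod (Set.finite_univ (α := B)))).subset ?_
  rintro ⟨w, b⟩ ⟨p, hpk, hpx⟩
  refine ⟨?_, Set.mem_univ _⟩
  rw [T.cell_eq_image] at hpk
  obtain ⟨y, hy, rfl⟩ := hpk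
  have h1 : ‖intVec w + y‖ ≤ ‖x‖ + 1 := by
    rw [mem_ball_iff_norm] at hpx
    have := norm_sub_norm_le (intVec w + y) x
    linarith
  have h2 := (hR b y hy).trans (hM b)
  have h3 : ‖(intVec w : Space d)‖ ≤ Q := by
    have : (intVec w : Space d) = (intVec w + y) - y := by abel
    rw [this]
    exact (norm_sub_le _ _).trans (by linarith)
  intro i _
  have h4 : |(w i : ℝ)| ≤ Q := by
    have := PiLp.norm_apply_le (intVec w : Space d) i
    simp only [intVec, Real.norm_eq_abs] at this
    exact this.trans h3
  have h5 : |(w i : ℝ)| ≤ (⌈Q⌉ : ℤ) := h4.trans (Int.le_ceil _)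
  rw [abs_le] at h5
  exact ⟨by exact_mod_cast h5.1, by exact_mod_cast h5.2⟩

theorem notMem_interior_of_mem (hjk : j ≠ k) (hx : x ∈ T.cell j) : x ∉ interior (T.cell k) := by
  intro hxk
  rw [← (T.isPolytope j).closure_interior] at hx
  obtain ⟨y, hyk, hyj⟩ := mem_closure_iff.1 hx _ isOpen_interior hxk
  exact Set.disjoint_left.1 (T.disjoint j k hjk) hyj hyk

/-- By local finiteness the union of the other elements is closed. It contains the complement of
K_j, hence also its boundary points. -/
theorem exists_mem_face [Finite B] (hx : x ∈ frontier (T.cell j)) : ∃ k ≠ j, x ∈ T.face j k := by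
  have hcl : IsClosed (⋃ k : {k // k ≠ j}, T.cell k) :=
    (T.locallyFinite_cell.comp_injective Subtype.val_injective).isClosed_iUnion
      fun k => T.isClosed_cell k
  have hsub : (T.cell j)ᶜ ⊆ ⋃ k : {k // k ≠ j}, T.cell k := by
    intro y hy
    have : y ∈ ⋃ k, T.cell k := by rw [T.cover]; trivial
    obtain ⟨k, hk⟩ := Set.mem_iUnion.1 this
    exact Set.mem_iUnion.2 ⟨⟨k, fun h => hy (h ▸ hk)⟩, hk⟩
  have h1 : x ∈ closure (T.cell j)ᶜ := by
    rw [closure_compl]; exact hx.2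
  obtain ⟨⟨k, hkj⟩, hk⟩ := Set.mem_iUnion.1 (hcl.closure_subset_iff.2 hsub h1)
  exact ⟨k, hkj, hx, subset_closure hk,
    T.notMem_interior_of_mem hkj.symm ((T.isClosed_cell j).frontier_subset hx)⟩

variable {T}

theorem IsUnitNormal.eventually_mem_interior (h : T.IsUnitNormal j k x ν) :
    ∃ ε > 0, ∀ y ∈ Metric.ball x ε, 0 < inner ℝ ν (y - x) → y ∈ interior (T.cell k) := by
  obtain ⟨-, ε, hε, h⟩ := h
  refine ⟨ε, hε, fun y hy hpos => ?_⟩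
  have hopen : IsOpen (Metric.ball x ε ∩ {z | 0 < inner ℝ ν (z - x)}) :=
    Metric.isOpen_ball.inter (isOpen_lt continuous_const (by fun_prop))
  exact interior_maximal (fun w hw => (h w hw.1).1 hw.2) hopen ⟨hy, hpos⟩

theorem IsUnitNormal.isOutwardNormal (hjk : j ≠ k) (h : T.IsUnitNormal j k x ν) :
    IsOutwardNormal (T.cell j) x ν := by
  obtain ⟨ε, hε, h1⟩ := h.eventually_mem_interior
  obtain ⟨-, ε', hε', h2⟩ := h
  refine ⟨min ε ε', lt_min hε hε', fun y hy => ⟨fun h0 hyj => ?_, fun h0 => ?_⟩⟩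
  · exact T.notMem_interior_of_mem hjk hyj
      (h1 y (Metric.ball_subset_ball (min_le_left _ _) hy) h0)
  · exact (h2 y (Metric.ball_subset_ball (min_le_right _ _) hy)).2 h0

theorem IsUnitNormal.symm (h : T.IsUnitNormal j k x ν) : T.IsUnitNormal k j x (-ν) := by
  obtain ⟨hν, ε, hε, h⟩ := h
  refine ⟨by rwa [norm_neg], ε, hε, fun y hy => ⟨fun h0 => (h y hy).2 ?_, fun h0 => (h y hy).1 ?_⟩⟩
  all_goals rw [inner_neg_left] at h0; linarith

theorem IsUnitNormal.unitNormal_eq (hjk : j ≠ k) (h : T.IsUnitNormal j k x ν) :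
    T.unitNormal j k x = ν := by
  have hex : ∃ ν, T.IsUnitNormal j k x ν := ⟨ν, h⟩
  rw [unitNormal, dif_pos hex]
  exact (hex.choose_spec.isOutwardNormal hjk).eq hex.choose_spec.1 h.1 (h.isOutwardNormal hjk)

/-- Both neighbours would contain the points just ahead of x along the common normal in their
interiors. This makes the regular parts of different faces of K_j disjoint. -/
theorem IsUnitNormal.neighbor_eq (hjk : j ≠ k) (hjl : j ≠ l) {ν' : Space d}
    (h : T.IsUnitNormal j k x ν) (h' : T.IsUnitNormal j l x ν') : k = l := by
  by_contra hkl
  obtain rfl := (h.isOutwardNormal hjk).eq h.1 h'.1 (h'.isOutwardNormal hjl)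
  obtain ⟨ε, hε, h1⟩ := h.eventually_mem_interior
  obtain ⟨ε', hε', h2⟩ := h'.eventually_mem_interior
  obtain ⟨t, ht1, ht2, ht0⟩ := ((eventually_add_smul_mem_ball x ν hε).and
    ((eventually_add_smul_mem_ball x ν hε').and self_mem_nhdsWithin)).exists
  have hpos : 0 < inner ℝ ν (x + t • ν - x) := by
    rw [add_sub_cancel_left, inner_smul_right, real_inner_self_eq_norm_sq, h.1]
    simpa using ht0
  exact Set.disjoint_left.1 (T.disjoint k l hkl) (h1 _ ht1 hpos) (h2 _ ht2 hpos)

theorem face_comm (j k : T.Elem) : T.face j k = T.face k j := Set.inter_comm _ _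

theorem mem_nbr_comm : k ∈ T.nbr j ↔ j ∈ T.nbr k := by
  simp only [nbr, Set.mem_ofPred_eq, T.face_comm j k, ne_comm]

theorem faceCenter_comm (j k : T.Elem) : T.faceCenter j k = T.faceCenter k j := by
  rw [faceCenter, face_comm, faceCenter]

/-- Discards a null set from the face so that planarity and the normal hold at every remaining
point. The rest is nonempty because the face has nonzero measure, and this is what gives ‖ν‖ = 1. -/
theorem PlanarFaces.exists_face (hT : T.PlanarFaces) (hk : k ∈ T.nbr j) :
    ∃ (ν : Space d) (c : ℝ) (F : Set (Space d)), ‖ν‖ = 1 ∧ MeasurableSet F ∧ F ⊆ T.face j k ∧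
      μHE[d - 1] (T.face j k \ F) = 0 ∧ ∀ x ∈ F, inner ℝ ν x = c ∧ T.IsUnitNormal j k x ν := by
  obtain ⟨ν, c, h⟩ := hT j k hk
  rw [ae_restrict_iff' (T.measurableSet_face j k)] at h
  obtain ⟨s, hs, hsm, hs0⟩ := exists_measurable_superset_of_null (ae_iff.1 h)
  have hF : ∀ x ∈ T.face j k \ s, inner ℝ ν x = c ∧ T.IsUnitNormal j k x ν := by
    intro x hx
    by_contra hcon
    exact hx.2 (hs fun h => hcon (h hx.1))
  have h0 : μHE[d - 1] (T.face j k \ (T.face j k \ s)) = 0 :=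
    measure_mono_null (fun x hx => by_contra fun h => hx.2 ⟨hx.1, h⟩) hs0
  have hne : (T.face j k \ s).Nonempty := by
    by_contra hcon
    rw [Set.not_nonempty_iff_eq_empty] at hcon
    rw [hcon, Set.sdiff_empty] at h0
    exact hk.2 h0
  obtain ⟨x, hx⟩ := hne
  exact ⟨ν, c, T.face j k \ s, (hF x hx).2.1, (T.measurableSet_face j k).diff hsm,
    Set.sdiff_subset, h0, hF⟩

/-- Up to a null set the face is a bounded part of one hyperplane. Finiteness makes the averages
over the face, in particular its mass center, genuine. -/
theorem PlanarFaces.measure_face_ne_top (hT : T.PlanarFaces) (hk : k ∈ T.nbr j) :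
    μHE[d - 1] (T.face j k) ≠ ⊤ := by
  obtain ⟨ν, c, F, hν, hFm, hFs, hF0, hF⟩ := hT.exists_face hk
  have hle : μHE[d - 1] (T.face j k) ≤ μHE[d - 1] F + μHE[d - 1] (T.face j k \ F) :=
    (measure_mono (by rw [Set.union_sdiff_cancel hFs])).trans (measure_union_le _ _)
  rw [hF0, add_zero] at hle
  refine ne_top_of_le_ne_top ?_ hle
  have h1 : μHE[d - 1] F =
      ((μHE[d - 1] : Measure (Space d)).restrict {x | inner ℝ ν x = c}) F := by
    rw [Measure.restrict_apply hFm, Set.inter_eq_left.2 (show F ⊆ {x | inner ℝ ν x = c} from fun x hx => (hF x hx).1)]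
  have hg : Measurable (fun w : (Submodule.span ℝ {ν})ᗮ => c • ν + (w : Space d)) := by fun_prop
  rw [h1, ← map_orthogonal_volume hν, Measure.map_apply hg hFm]
  obtain ⟨R, hR⟩ := (T.isCompact_face j k).isBounded.exists_norm_le
  refine ne_top_of_le_ne_top
    (measure_closedBall_lt_top (x := (0 : (Submodule.span ℝ {ν})ᗮ)) (r := R + ‖c • ν‖)).ne
    (measure_mono fun w hw => ?_)
  have h2 := hR _ (hFs hw)
  have h3 := norm_sub_le (c • ν + (w : Space d)) (c • ν)
  rw [add_sub_cancel_left] at h3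
  rw [mem_closedBall_zero_iff, Submodule.coe_norm]
  linarith

theorem faceNormal_eq (hkj : k ≠ j) {F : Set (Space d)}
    (hF0 : μHE[d - 1] (T.face j k \ F) = 0) (hF : ∀ x ∈ F, T.IsUnitNormal j k x ν) :
    T.faceNormal j k = (μHE[d - 1] : Measure (Space d)).real (T.face j k) • ν := by
  rw [faceNormal, ← setIntegral_const]
  refine integral_congr_ae ?_
  rw [Filter.EventuallyEq, ae_restrict_iff' (T.measurableSet_face j k)]
  filter_upwards [measure_eq_zero_iff_ae_notMem.1 hF0] with x hx hxf
  exact (hF x (by_contra fun h => hx ⟨hxf, h⟩)).unitNormal_eq hkj.symm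

theorem PlanarFaces.faceNormal_comm (hT : T.PlanarFaces) (hk : k ∈ T.nbr j) :
    T.faceNormal k j = -T.faceNormal j k := by
  obtain ⟨ν, c, F, hν, hFm, hFs, hF0, hF⟩ := hT.exists_face hk
  rw [faceNormal_eq hk.1 hF0 fun x hx => (hF x hx).2, faceNormal_eq (ν := -ν) hk.1.symm
    (by rwa [face_comm]) fun x hx => (hF x hx).2.symm, face_comm, smul_neg]

variable {V : Type*} [NormedAddCommGroup V] [NormedSpace ℝ V] [CompleteSpace V]

/-- The divergence theorem on a mesh element. -/
theorem PlanarFaces.setIntegral_fderiv_cell [Finite B] (hT : T.PlanarFaces) (hd : 1 ≤ d)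
    (j : T.Elem) {f : Space d → V} (hf : ContDiff ℝ 1 f) (e : Space d) :
    ∫ x in T.cell j, fderiv ℝ f x e = ∑ k ∈ (T.nbr_finite j).toFinset,
      (inner ℝ (T.faceNormal j k) e : ℝ) • ⨍ x in T.face j k, f x ∂μHE[d - 1] := by
  classical
  have hex : ∀ k : T.Elem, ∃ (ν : Space d) (c : ℝ) (F : Set (Space d)), k ∈ T.nbr j → ‖ν‖ = 1 ∧
      MeasurableSet F ∧ F ⊆ T.face j k ∧
      μHE[d - 1] (T.face j k \ F) = 0 ∧ ∀ x ∈ F, inner ℝ ν x = c ∧ T.IsUnitNormal j k x ν := by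
    intro k
    by_cases hk : k ∈ T.nbr j
    · obtain ⟨ν, c, F, h⟩ := hT.exists_face hk
      exact ⟨ν, c, F, fun _ => h⟩
    · exact ⟨0, 0, ∅, fun h => absurd h hk⟩
  choose ν c F h using hex
  have hmem : ∀ k, k ∈ (T.nbr_finite j).toFinset ↔ k ∈ T.nbr j := fun k =>
    (T.nbr_finite j).mem_toFinset
  have hcov : μHE[d - 1] (frontier (T.cell j) \ ⋃ k ∈ (T.nbr_finite j).toFinset, F k) = 0 := by
    -- What the regular parts leave uncovered lies in countably many null sets: the discarded parts
    -- of the faces with neighbours, and the whole contacts with elements outside N(j), null by the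
    -- definition of `nbr`.
    have hsub : frontier (T.cell j) \ ⋃ k ∈ (T.nbr_finite j).toFinset, F k ⊆
        ⋃ k ∈ {k | k ≠ j}, (T.face j k \ if k ∈ T.nbr j then F k else ∅) := by
      intro x hx
      obtain ⟨k, hkj, hxk⟩ := T.exists_mem_face hx.1
      refine Set.mem_biUnion (x := k) hkj ⟨hxk, fun hxF => ?_⟩
      split_ifs at hxF with hk
      · exact hx.2 (Set.mem_biUnion ((hmem k).2 hk) hxF)
      · exact hxF
    refine measure_mono_null hsub ((measure_biUnion_null_iff (Set.to_countable _)).2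
      fun k hkj => ?_)
    split_ifs with hk
    · exact (h k hk).2.2.2.1
    · rw [Set.sdiff_empty]
      by_contra h0
      exact hk ⟨hkj, h0⟩
  rw [(T.isPolytope j).setIntegral_fderiv_eq_sum (N := (T.nbr_finite j).toFinset) (F := F) (ν := ν)
    (c := c) hd (fun k hk => (h k ((hmem k).1 hk)).1) (fun k hk => (h k ((hmem k).1 hk)).2.1)
    (fun k hk x hx => ((h k ((hmem k).1 hk)).2.2.2.2 x hx).1)
    (fun k hk x hx => ((h k ((hmem k).1 hk)).2.2.1 hx).1)
    (fun k hk x hx => (((h k ((hmem k).1 hk)).2.2.2.2 x hx).2).isOutwardNormal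
      ((hmem k).1 hk).1.symm)
    (fun k hk l hl hkl => Set.disjoint_left.2 fun x hxk hxl => hkl
      (((h k ((hmem k).1 hk)).2.2.2.2 x hxk).2.neighbor_eq ((hmem k).1 hk).1.symm
        ((hmem l).1 hl).1.symm ((h l ((hmem l).1 hl)).2.2.2.2 x hxl).2))
    hcov hf e]
  refine Finset.sum_congr rfl fun k hk => ?_
  have hk' := (hmem k).1 hk
  obtain ⟨-, -, h3, h4, h5⟩ := h k hk'
  have hF : F k =ᵐ[μHE[d - 1]] T.face j k :=
    h3.eventuallyLE.antisymm (ae_le_set.2 h4)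
  have hpos : (μHE[d - 1] : Measure (Space d)).real (T.face j k) ≠ 0 := by
    rw [Measure.real, ENNReal.toReal_ne_zero]
    exact ⟨hk'.2, hT.measure_face_ne_top hk'⟩
  rw [faceNormal_eq hk'.1 h4 fun x hx => (h5 x hx).2, setIntegral_congr_set hF, setAverage_eq,
    real_inner_smul_left, smul_smul]
  congr 1
  field_simp

end PeriodicMesh

/-! ### Averages of affine functions and averages over translated sets. -/

section Average

variable {d : ℕ} {V : Type*} [NormedAddCommGroup V] [NormedSpace ℝ V]
  {μ : Measure (Space d)} {s : Set (Space d)}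

theorem integrableOn_id_of_isCompact (hs : IsCompact s) (ht : μ s ≠ ⊤) :
    IntegrableOn (fun x => x) s μ := by
  obtain ⟨R, hR⟩ := hs.isBounded.exists_norm_le
  exact Measure.integrableOn_of_bounded ht continuous_id.aestronglyMeasurable
    ((ae_restrict_mem hs.measurableSet).mono fun x hx => hR x hx)

theorem setIntegral_affine [CompleteSpace V] (hs : IsCompact s) (h0 : μ s ≠ 0) (ht : μ s ≠ ⊤)
    (a : V) (L : Space d →L[ℝ] V) :
    ∫ x in s, (a + L x) ∂μ = μ.real s • (a + L (⨍ x in s, x ∂μ)) := by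
  have hi := integrableOn_id_of_isCompact hs ht
  have hpos : μ.real s ≠ 0 := by
    rw [Measure.real, ENNReal.toReal_ne_zero]; exact ⟨h0, ht⟩
  have hc : Integrable (fun _ => a) (μ.restrict s) := integrableOn_const ht enorm_ne_top
  rw [integral_add hc (L.integrable_comp hi), L.integral_comp_comm hi,
    setIntegral_const, setAverage_eq, map_smul, smul_add, smul_inv_smul₀ hpos]

theorem setAverage_affine [CompleteSpace V] (hs : IsCompact s) (h0 : μ s ≠ 0) (ht : μ s ≠ ⊤)
    (a : V) (L : Space d →L[ℝ] V) :
    ⨍ x in s, (a + L x) ∂μ = a + L (⨍ x in s, x ∂μ) := by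
  have hpos : μ.real s ≠ 0 := by
    rw [Measure.real, ENNReal.toReal_ne_zero]; exact ⟨h0, ht⟩
  rw [setAverage_eq, setIntegral_affine hs h0 ht, inv_smul_smul₀ hpos]

theorem setAverage_image_add_left [μ.IsAddLeftInvariant] (s : Set (Space d)) (v : Space d)
    (f : Space d → V) :
    ⨍ x in (fun x => v + x) '' s, f x ∂μ = ⨍ x in s, f (v + x) ∂μ := by
  have hmp : MeasurePreserving (fun x => v + x) μ μ := measurePreserving_add_left μ v
  have hemb : MeasurableEmbedding (fun x : Space d => v + x) := measurableEmbedding_addLeft v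
  have h1 : μ ((fun x => v + x) '' s) = μ s := by
    rw [← hmp.measure_preimage_emb hemb, Set.preimage_image_eq _ hemb.injective]
  rw [setAverage_eq, setAverage_eq, hmp.setIntegral_image_emb hemb, Measure.real, h1, Measure.real]

end Average

/-! ### Invariance of the mesh geometry under integer translations. -/

namespace PeriodicMesh

variable {d : ℕ} {B : Type*} {T : PeriodicMesh d B} {j k m : T.Elem} {z : Fin d → ℤ}

theorem shift_neg_shift (z : Fin d → ℤ) (j : T.Elem) : T.shift (-z) (T.shift z j) = j := by
  simp [shift]

theorem shift_shift_neg (z : Fin d → ℤ) (j : T.Elem) : T.shift z (T.shift (-z) j) = j := by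
  simp [shift]

/-- The translation of the mesh elements by an integer vector as a permutation. -/
def shiftEquiv (T : PeriodicMesh d B) (z : Fin d → ℤ) : T.Elem ≃ T.Elem where
  toFun := T.shift z
  invFun := T.shift (-z)
  left_inv := shift_neg_shift z
  right_inv := shift_shift_neg z

@[simp]
theorem shiftEquiv_apply (z : Fin d → ℤ) (j : T.Elem) : T.shiftEquiv z j = T.shift z j := rfl

theorem cell_shift_eq (z : Fin d → ℤ) (j : T.Elem) :
    T.cell (T.shift z j) = (fun x => intVec z + x) '' T.cell j := T.cell_shift z j.1 j.2

theorem volume_cell_ne_zero (j : T.Elem) : volume (T.cell j) ≠ 0 := by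
  have hne : (interior (T.cell j)).Nonempty := by
    rw [← closure_nonempty_iff, (T.isPolytope j).closure_interior]
    exact (T.isPolytope j).nonempty
  exact ((isOpen_interior.measure_pos volume hne).trans_le (measure_mono interior_subset)).ne'

theorem volume_cell_ne_top (j : T.Elem) : volume (T.cell j) ≠ ⊤ :=
  (T.isPolytope j).isCompact.measure_lt_top.ne

theorem vol_ne_zero (j : T.Elem) : T.vol j ≠ 0 := by
  rw [vol, Measure.real, ENNReal.toReal_ne_zero]
  exact ⟨volume_cell_ne_zero j, volume_cell_ne_top j⟩

theorem center_shift (z : Fin d → ℤ) (j : T.Elem) :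
    T.center (T.shift z j) = intVec z + T.center j := by
  rw [center, cell_shift_eq, setAverage_image_add_left]
  exact setAverage_affine (T.isPolytope j).isCompact (volume_cell_ne_zero j)
    (volume_cell_ne_top j) (intVec z) (ContinuousLinearMap.id ℝ (Space d))

theorem face_shift (z : Fin d → ℤ) (j k : T.Elem) :
    T.face (T.shift z j) (T.shift z k) = (fun x => intVec z + x) '' T.face j k := by
  have h : ∀ s : Set (Space d), frontier ((fun x => intVec z + x) '' s) =
      (fun x => intVec z + x) '' frontier s := fun s =>
    ((Homeomorph.addLeft (intVec z : Space d)).image_frontier s).symm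
  rw [face, cell_shift_eq, cell_shift_eq, h, h, face,
    Set.image_inter (add_right_injective (intVec z : Space d))]

theorem shift_mem_nbr : T.shift z k ∈ T.nbr (T.shift z j) ↔ k ∈ T.nbr j := by
  have h : μHE[d - 1] (T.face (T.shift z j) (T.shift z k)) = μHE[d - 1] (T.face j k) := by
    rw [face_shift, ← (measurePreserving_add_left (μHE[d - 1] : Measure (Space d))
      (intVec z)).measure_preimage_emb (measurableEmbedding_addLeft _),
      Set.preimage_image_eq _ (add_right_injective _)]
  have hinj : T.shift z k = T.shift z j ↔ k = j := (T.shiftEquiv z).injective.eq_iff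
  simp only [nbr, Set.mem_ofPred_eq, h, ne_eq, hinj]

theorem PlanarFaces.setAverage_face_affine (hT : T.PlanarFaces) (hk : k ∈ T.nbr j)
    {V : Type*} [NormedAddCommGroup V] [NormedSpace ℝ V] [CompleteSpace V] (a : V)
    (L : Space d →L[ℝ] V) :
    ⨍ x in T.face j k, (a + L x) ∂μHE[d - 1] = a + L (T.faceCenter j k) :=
  setAverage_affine (T.isCompact_face j k) hk.2 (hT.measure_face_ne_top hk) a L

theorem PlanarFaces.faceCenter_shift (hT : T.PlanarFaces) (hk : k ∈ T.nbr j) (z : Fin d → ℤ) :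
    T.faceCenter (T.shift z j) (T.shift z k) = intVec z + T.faceCenter j k := by
  rw [faceCenter, face_shift, setAverage_image_add_left]
  exact hT.setAverage_face_affine hk (intVec z) (ContinuousLinearMap.id ℝ (Space d))

theorem PlanarFaces.faceNormal_shift (hT : T.PlanarFaces) (hk : k ∈ T.nbr j) (z : Fin d → ℤ) :
    T.faceNormal (T.shift z j) (T.shift z k) = T.faceNormal j k := by
  have h : ∀ x ν, T.IsUnitNormal j k x ν →
      T.IsUnitNormal (T.shift z j) (T.shift z k) (intVec z + x) ν := by
    rintro x ν ⟨hν, ε, hε, h⟩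
    refine ⟨hν, ε, hε, fun y hy => ?_⟩
    have h1 := h (y - intVec z) (by
      rw [mem_ball_iff_norm] at hy ⊢
      rwa [sub_sub])
    rw [sub_sub] at h1
    rw [cell_shift_eq, cell_shift_eq]
    exact ⟨fun h0 => ⟨_, h1.1 h0, by simp⟩, fun h0 => ⟨_, h1.2 h0, by simp⟩⟩
  obtain ⟨ν, c, F, hν, hFm, hFs, hF0, hF⟩ := hT.exists_face hk
  have hmp := measurePreserving_add_left (μHE[d - 1] : Measure (Space d)) (intVec z)
  have hemb := measurableEmbedding_addLeft (intVec z : Space d)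
  have hinj := add_right_injective (intVec z : Space d)
  rw [faceNormal_eq hk.1 hF0 fun x hx => (hF x hx).2,
    faceNormal_eq (F := (fun x => intVec z + x) '' F) (ν := ν) (shift_mem_nbr.2 hk).1]
  · rw [face_shift, Measure.real, ← hmp.measure_preimage_emb hemb, Set.preimage_image_eq _ hinj,
      Measure.real]
  · rw [face_shift, ← Set.image_sdiff hinj, ← hmp.measure_preimage_emb hemb,
      Set.preimage_image_eq _ hinj, hF0]
  · rintro _ ⟨x, hx, rfl⟩
    exact h x ν (hF x hx).2

theorem shift_mem_vertexNbr (hm : m ∈ T.vertexNbr j) (z : Fin d → ℤ) :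
    T.shift z m ∈ T.vertexNbr (T.shift z j) := by
  obtain ⟨x, ⟨hx1, hx2⟩, hx3⟩ := hm
  refine ⟨intVec z + x, ⟨(T.nodes_shift z x).2 hx1, ?_⟩, ?_⟩
  · rw [cell_shift_eq]; exact ⟨x, hx2, rfl⟩
  · rw [cell_shift_eq]; exact ⟨x, hx3, rfl⟩

theorem IsSimplex.map_shift {S S' : Set T.Elem} {σ : Finset T.Elem} (h : T.IsSimplex S σ)
    (hS : ∀ m ∈ S, T.shift z m ∈ S') :
    T.IsSimplex S' (σ.map (T.shiftEquiv z).toEmbedding) := by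
  obtain ⟨h1, h2, h3⟩ := h
  refine ⟨by rwa [Finset.card_map], ?_, ?_⟩
  · intro m hm
    obtain ⟨p, hp, rfl⟩ := Finset.mem_map.1 hm
    exact hS p (h2 p hp)
  · let g : σ.map (T.shiftEquiv z).toEmbedding → σ := fun m =>
      ⟨T.shift (-z) m, by
        obtain ⟨m, hm⟩ := m
        obtain ⟨p, hp, rfl⟩ := Finset.mem_map.1 hm
        simpa [shift_neg_shift] using hp⟩
    have hg : Function.Injective g := by
      intro a b hab
      have := congrArg Subtype.val hab
      exact Subtype.ext ((T.shiftEquiv (-z)).injective this)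
    have h4 := (h3.comp_embedding ⟨g, hg⟩).map' (AffineEquiv.constVAdd ℝ (Space d)
      (intVec z)).toAffineMap (AffineEquiv.injective _)
    convert h4 using 1
    ext1 m
    simp only [Function.comp, AffineEquiv.coe_toAffineMap, AffineEquiv.constVAdd_apply,
      Function.Embedding.coeFn_mk, g, vadd_eq_add]
    rw [← center_shift, shift_shift_neg]

theorem IsMinusSimplex.map_shift {σ : Finset T.Elem} (h : T.IsMinusSimplex j σ) (z : Fin d → ℤ) :
    T.IsMinusSimplex (T.shift z j) (σ.map (T.shiftEquiv z).toEmbedding) :=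
  IsSimplex.map_shift h fun _ hm => shift_mem_vertexNbr hm z

theorem IsPlusSimplex.map_shift {σ : Finset T.Elem} (h : T.IsPlusSimplex j k σ)
    (z : Fin d → ℤ) :
    T.IsPlusSimplex (T.shift z j) (T.shift z k) (σ.map (T.shiftEquiv z).toEmbedding) := by
  refine ⟨Finset.mem_map.2 ⟨k, h.1, rfl⟩, IsSimplex.map_shift h.2 fun m hm => ?_⟩
  rcases hm with rfl | hm
  · exact Set.mem_insert _ _
  · exact Set.mem_insert_of_mem _ (shift_mem_vertexNbr hm z)

open scoped Pointwise in
theorem hull_map_shift {σ : Finset T.Elem} {x : Space d} (h : x ∈ T.hull σ) (z : Fin d → ℤ) :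
    intVec z + x ∈ T.hull (σ.map (T.shiftEquiv z).toEmbedding) := by
  have h1 : T.center '' (σ.map (T.shiftEquiv z).toEmbedding : Finset T.Elem) =
      (intVec z : Space d) +ᵥ (T.center '' (σ : Set T.Elem)) := by
    ext y
    simp only [Finset.coe_map, Set.image_image, Equiv.coe_toEmbedding, shiftEquiv_apply,
      center_shift, Set.mem_vadd_set, vadd_eq_add, Set.mem_image, exists_exists_and_eq_and]
  rw [hull, h1, convexHull_vadd]
  exact ⟨x, h, rfl⟩

theorem PlanarFaces.linePoint_shift (hT : T.PlanarFaces) (hk : k ∈ T.nbr j) (z : Fin d → ℤ)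
    (t : ℝ) :
    T.linePoint (T.shift z j) (T.shift z k) t = intVec z + T.linePoint j k t := by
  rw [linePoint, hT.faceCenter_shift hk, center_shift, linePoint, add_sub_add_left_eq_sub,
    add_assoc]

theorem PlanarFaces.minusParams_shift (hT : T.PlanarFaces) (hk : k ∈ T.nbr j) (z : Fin d → ℤ) :
    T.minusParams (T.shift z j) (T.shift z k) = T.minusParams j k := by
  have key : ∀ (z : Fin d → ℤ) (j k : T.Elem), k ∈ T.nbr j →
      T.minusParams j k ⊆ T.minusParams (T.shift z j) (T.shift z k) := by
    rintro z j k hk t ⟨ht, σ, hσ, hmem⟩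
    refine ⟨ht, _, hσ.map_shift z, ?_⟩
    rw [hT.linePoint_shift hk]
    exact hull_map_shift hmem z
  refine (key z j k hk).antisymm' ?_
  have h := key (-z) (T.shift z j) (T.shift z k) (shift_mem_nbr.2 hk)
  rwa [shift_neg_shift, shift_neg_shift] at h

theorem PlanarFaces.plusParams_shift (hT : T.PlanarFaces) (hk : k ∈ T.nbr j) (z : Fin d → ℤ) :
    T.plusParams (T.shift z j) (T.shift z k) = T.plusParams j k := by
  have key : ∀ (z : Fin d → ℤ) (j k : T.Elem), k ∈ T.nbr j →
      T.plusParams j k ⊆ T.plusParams (T.shift z j) (T.shift z k) := by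
    rintro z j k hk t ⟨ht, σ, hσ, hmem⟩
    refine ⟨ht, _, hσ.map_shift z, ?_⟩
    rw [hT.linePoint_shift hk]
    exact hull_map_shift hmem z
  refine (key z j k hk).antisymm' ?_
  have h := key (-z) (T.shift z j) (T.shift z k) (shift_mem_nbr.2 hk)
  rwa [shift_neg_shift, shift_neg_shift] at h

theorem SimplexChoice.minus_shift_eq (C : T.SimplexChoice) (z : Fin d → ℤ) (j k : T.Elem) :
    C.minus (T.shift z j) (T.shift z k) = (C.minus j k).map (T.shiftEquiv z).toEmbedding := by
  ext m
  have h := C.minus_shift z j k ((T.shiftEquiv z).symm m)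
  rwa [← shiftEquiv_apply z (Equiv.symm _ _), Equiv.apply_symm_apply, ← Finset.mem_map_equiv] at h

theorem SimplexChoice.plus_shift_eq (C : T.SimplexChoice) (z : Fin d → ℤ) (j k : T.Elem) :
    C.plus (T.shift z j) (T.shift z k) = (C.plus j k).map (T.shiftEquiv z).toEmbedding := by
  ext m
  have h := C.plus_shift z j k ((T.shiftEquiv z).symm m)
  rwa [← shiftEquiv_apply z (Equiv.symm _ _), Equiv.apply_symm_apply, ← Finset.mem_map_equiv] at h

/-! ### Interpolation and reconstruction: linearity, translation invariance, exactness on affine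
functions. -/

section Interpolation

variable {n : ℕ} {σ : Finset T.Elem} {x : Space d}

theorem exists_weights {S : Set T.Elem} (hσ : T.IsSimplex S σ) (hx : x ∈ T.hull σ) :
    ∃ w : T.Elem → ℝ, ∑ m ∈ σ, w m = 1 ∧ ∑ m ∈ σ, w m • T.center m = x := by
  classical
  have hinj : Set.InjOn T.center σ := fun a ha b hb hab =>
    congrArg Subtype.val (hσ.2.2.injective (a₁ := ⟨a, ha⟩) (a₂ := ⟨b, hb⟩) hab)
  rw [hull, ← Finset.coe_image, Finset.mem_convexHull'] at hx
  obtain ⟨w, -, h1, h2⟩ := hx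
  rw [Finset.sum_image hinj] at h1 h2
  exact ⟨fun m => w (T.center m), h1, h2⟩

/-- Affine independence makes barycentric coordinates unique, so the weights picked by choice agree
with any others on σ. -/
theorem interp_eq {S : Set T.Elem} (hσ : T.IsSimplex S σ) {w : T.Elem → ℝ}
    (h1 : ∑ m ∈ σ, w m = 1) (h2 : ∑ m ∈ σ, w m • T.center m = x) (u : T.MeshFun n) :
    T.interp σ x u = ∑ m ∈ σ, w m • u m := by
  have hex : ∃ w : T.Elem → ℝ, ∑ m ∈ σ, w m = 1 ∧ ∑ m ∈ σ, w m • T.center m = x := ⟨w, h1, h2⟩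
  rw [interp, dif_pos hex]
  obtain ⟨h1', h2'⟩ := hex.choose_spec
  set w' := hex.choose
  have h3 := affineIndependent_iff.1 hσ.2.2 Finset.univ (fun m => w' m - w m)
    (by
      rw [Finset.sum_coe_sort σ (fun m => w' m - w m), Finset.sum_sub_distrib, h1, h1', sub_self])
    (by
      rw [Finset.sum_coe_sort σ (fun m => (w' m - w m) • T.center m)]
      simp only [sub_smul, Finset.sum_sub_distrib, h2, h2', sub_self])
  refine Finset.sum_congr rfl fun m hm => ?_
  rw [sub_eq_zero.1 (h3 ⟨m, hm⟩ (Finset.mem_univ _))]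

theorem interp_affine {S : Set T.Elem} (hσ : T.IsSimplex S σ) (hx : x ∈ T.hull σ)
    (a : Fin n → ℂ) (L : Space d →L[ℝ] Fin n → ℂ) :
    T.interp σ x (T.pointValues fun y => a + L y) = a + L x := by
  obtain ⟨w, h1, h2⟩ := exists_weights hσ hx
  rw [interp_eq hσ h1 h2]
  simp only [pointValues, smul_add, Finset.sum_add_distrib, ← Finset.sum_smul, h1, one_smul,
    ← map_smul, ← map_sum, h2]

theorem interp_map_shift {S : Set T.Elem} (hσ : T.IsSimplex S σ) (hx : x ∈ T.hull σ)
    (z : Fin d → ℤ) (u : T.MeshFun n) :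
    T.interp (σ.map (T.shiftEquiv z).toEmbedding) (intVec z + x) u =
      T.interp σ x fun m => u (T.shift z m) := by
  obtain ⟨w, h1, h2⟩ := exists_weights hσ hx
  rw [interp_eq hσ h1 h2, interp_eq (IsSimplex.map_shift (S' := Set.univ) hσ fun _ _ => trivial)
    (w := fun m => w (T.shift (-z) m))]
  · simp only [Finset.sum_map, Equiv.coe_toEmbedding, shiftEquiv_apply, shift_neg_shift]
  · simpa only [Finset.sum_map, Equiv.coe_toEmbedding, shiftEquiv_apply, shift_neg_shift] using h1
  · simp only [Finset.sum_map, Equiv.coe_toEmbedding, shiftEquiv_apply, shift_neg_shift,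
      center_shift, smul_add, Finset.sum_add_distrib, ← Finset.sum_smul, h1, h2, one_smul]

/-- The chosen weights depend on σ and x but not on the mesh function, so no nondegeneracy is
needed. -/
theorem interp_sub (σ : Finset T.Elem) (x : Space d) (u v : T.MeshFun n) :
    T.interp σ x (u - v) = T.interp σ x u - T.interp σ x v := by
  unfold interp
  split_ifs
  · simp only [Pi.sub_apply, smul_sub, Finset.sum_sub_distrib]
  · simp

theorem recon_sub (C : T.SimplexChoice) (u v : T.MeshFun n) (j k : T.Elem) :
    T.recon C (u - v) j k = T.recon C u j k - T.recon C v j k := by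
  unfold recon
  split_ifs
  · simp only [interp_sub, Pi.sub_apply]
    module
  · rfl

theorem PlanarFaces.recon_shift (hT : T.PlanarFaces) (C : T.SimplexChoice) (u : T.MeshFun n)
    (hk : k ∈ T.nbr j) (z : Fin d → ℤ) :
    T.recon C u (T.shift z j) (T.shift z k) = T.recon C (fun m => u (T.shift z m)) j k := by
  have hm := hT.minusParams_shift hk z
  have hp := hT.plusParams_shift hk z
  have hrm : T.rMinus (T.shift z j) (T.shift z k) = intVec z + T.rMinus j k := by
    rw [rMinus, hm, hT.linePoint_shift hk, rMinus]
  have hrp : T.rPlus (T.shift z j) (T.shift z k) = intVec z + T.rPlus j k := by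
    rw [rPlus, hp, hT.linePoint_shift hk, rPlus]
  by_cases h : T.MinusDefined j k ∧ T.PlusDefined j k
  · have h' : T.MinusDefined (T.shift z j) (T.shift z k) ∧
        T.PlusDefined (T.shift z j) (T.shift z k) := by
      rwa [MinusDefined, PlusDefined, hm, hp]
    rw [recon, if_pos h', recon, if_pos h, hrm, hrp, C.minus_shift_eq, C.plus_shift_eq,
      hT.faceCenter_shift hk, center_shift, add_sub_add_left_eq_sub, add_sub_add_left_eq_sub,
      add_sub_add_left_eq_sub, interp_map_shift (C.minus_spec j k hk h.1).1
        (C.minus_spec j k hk h.1).2, interp_map_shift (C.plus_spec j k hk h.2).1.2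
        (C.plus_spec j k hk h.2).2]
  · have h' : ¬ (T.MinusDefined (T.shift z j) (T.shift z k) ∧
        T.PlusDefined (T.shift z j) (T.shift z k)) := by
      rwa [MinusDefined, PlusDefined, hm, hp]
    rw [recon, if_neg h', recon, if_neg h]

/-- With v = r_jk - r_j, the interpolation points are r_j + sv and r_j - tv with s, t > 0.
Interpolation is exact on affine functions, so each divided difference is L v / ‖v‖, and the weights
2/3 and 1/3 add up to 1. -/
theorem recon_affine (C : T.SimplexChoice) (hk : k ∈ T.nbr j)
    (h : T.MinusDefined j k ∧ T.PlusDefined j k) (a : Fin n → ℂ)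
    (L : Space d →L[ℝ] Fin n → ℂ) :
    T.recon C (T.pointValues fun x => a + L x) j k = a + L (T.faceCenter j k) := by
  rw [recon, if_pos h, interp_affine (C.minus_spec j k hk h.1).1 (C.minus_spec j k hk h.1).2,
    interp_affine (C.plus_spec j k hk h.2).1.2 (C.plus_spec j k hk h.2).2]
  obtain ⟨t, ht⟩ := h.1
  obtain ⟨s, hs⟩ := h.2
  have ht0 : 0 < t := ht.1.1
  have hs0 : 0 < s := one_pos.trans_le hs.1.1
  rw [rMinus, rPlus, ht.csSup_eq, hs.csSup_eq]
  simp only [linePoint, pointValues]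
  set v := T.faceCenter j k - T.center j with hv
  have hfc : T.faceCenter j k = T.center j + v := by rw [hv]; abel
  rw [hfc, add_sub_cancel_left, sub_add_cancel_left, norm_neg, norm_smul, norm_smul,
    Real.norm_of_nonneg hs0.le, Real.norm_eq_abs, abs_neg, abs_of_pos ht0]
  -- If r_jk = r_j, both sides are simply the value at r_j.
  by_cases hv0 : v = 0
  · simp [hv0]
  have hn : ‖v‖ ≠ 0 := norm_ne_zero_iff.2 hv0
  simp only [map_add, map_smul, add_sub_add_left_eq_sub, add_sub_cancel_left,
    sub_add_cancel_left, neg_smul, map_neg, neg_neg, smul_smul, ← add_smul]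
  rw [add_assoc]
  congr 2
  rw [show ‖v‖ * (2 / 3 * ((s * ‖v‖)⁻¹ * s) + 1 / 3 * ((t * ‖v‖)⁻¹ * t)) = 1 by
    field_simp
    norm_num, one_smul]

end Interpolation

end PeriodicMesh

/-! ### Normal forms of polynomials of degree at most 1 and 2. -/

section Polynomial

variable {d n : ℕ}

/-- One variable is factored out of each nonconstant monomial. Applied once this gives the affine
normal form, applied again the quadratic one. -/
theorem _root_.MvPolynomial.exists_eq_C_add_sum_X_mul {R σ : Type*} [CommSemiring R] [Fintype σ]
    {p : ℕ} (q : MvPolynomial σ R) (hq : q.totalDegree ≤ p + 1) :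
    ∃ (a : R) (r : σ → MvPolynomial σ R), (∀ l, (r l).totalDegree ≤ p) ∧
      q = MvPolynomial.C a + ∑ l, MvPolynomial.X l * r l := by
  classical
  rw [q.as_sum]
  refine Finset.sum_induction _ (fun q : MvPolynomial σ R => ∃ (a : R) (r : σ → MvPolynomial σ R),
    (∀ l, (r l).totalDegree ≤ p) ∧ q = MvPolynomial.C a + ∑ l, MvPolynomial.X l * r l) ?_ ?_ ?_
  · rintro _ _ ⟨a, r, hr, rfl⟩ ⟨a', r', hr', rfl⟩
    refine ⟨a + a', r + r', fun l => (MvPolynomial.totalDegree_add _ _).trans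
      (max_le (hr l) (hr' l)), ?_⟩
    simp only [map_add, Pi.add_apply, mul_add, Finset.sum_add_distrib]
    abel
  · exact ⟨0, 0, fun l => by simp, by simp⟩
  · intro m hm
    have hdeg := (MvPolynomial.le_totalDegree hm).trans hq
    by_cases h0 : m = 0
    · exact ⟨q.coeff m, 0, fun l => by simp, by simp [h0]⟩
    obtain ⟨l, hl⟩ := Finsupp.ne_iff.1 h0
    have hle : Finsupp.single l 1 ≤ m := by
      rw [Finsupp.single_le_iff]
      exact Nat.one_le_iff_ne_zero.2 hl
    obtain ⟨m', rfl⟩ := exists_add_of_le hle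
    refine ⟨0, Pi.single l (MvPolynomial.monomial m' (q.coeff (Finsupp.single l 1 + m'))), ?_, ?_⟩
    · intro l'
      by_cases hll : l' = l
      · subst hll
        rw [Pi.single_eq_same]
        refine (MvPolynomial.totalDegree_monomial_le _ _).trans ?_
        rw [Finsupp.sum_add_index' (fun _ => rfl) (fun _ _ _ => rfl),
          Finsupp.sum_single_index rfl] at hdeg
        simp only [Finsupp.sum] at hdeg ⊢
        simp only [id] at *
        omega
      · simp [Pi.single_eq_of_ne hll]
    · rw [Finset.sum_eq_single l (fun l' _ h => by rw [Pi.single_eq_of_ne h, mul_zero])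
        (fun h => absurd (Finset.mem_univ l) h), Pi.single_eq_same, map_zero, zero_add,
        MvPolynomial.X, MvPolynomial.monomial_mul, one_mul]

theorem IsPoly.exists_affine {f : Space d → Fin n → ℂ} (hf : IsPoly 1 f) :
    ∃ (a : Fin n → ℂ) (L : Space d →L[ℝ] Fin n → ℂ), f = fun x => a + L x := by
  obtain ⟨q, hq, hfq⟩ := hf
  choose a r hr hqr using fun i => (q i).exists_eq_C_add_sum_X_mul (p := 0) (hq i)
  have hr' : ∀ i l, r i l = MvPolynomial.C ((r i l).coeff 0) := fun i l =>
    MvPolynomial.totalDegree_eq_zero_iff_eq_C.1 (Nat.le_zero.1 (hr i l))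
  refine ⟨a, ∑ l, (EuclideanSpace.proj l : Space d →L[ℝ] ℝ).smulRight
    (fun i => (r i l).coeff 0), ?_⟩
  ext x i
  rw [hfq, hqr]
  simp only [map_add, map_sum, map_mul, MvPolynomial.eval_C, MvPolynomial.eval_X]
  conv_lhs => enter [2, 2, l]; rw [hr' i l, MvPolynomial.eval_C]
  simp [Finset.sum_apply]

theorem IsPoly.exists_quadratic {f : Space d → Fin n → ℂ} (hf : IsPoly 2 f) :
    ∃ (a : Fin n → ℂ) (L : Space d →L[ℝ] Fin n → ℂ) (M : Fin d → Space d →L[ℝ] Fin n → ℂ),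
      f = fun x => a + L x + ∑ l, x l • M l x := by
  obtain ⟨q, hq, hfq⟩ := hf
  choose a r hr hqr using fun i => (q i).exists_eq_C_add_sum_X_mul (p := 1) (hq i)
  have haff : ∀ l, ∃ (b : Fin n → ℂ) (M : Space d →L[ℝ] Fin n → ℂ),
      (fun x i => MvPolynomial.eval (fun m => (x m : ℂ)) (r i l)) = fun x => b + M x := fun l =>
    IsPoly.exists_affine ⟨fun i => r i l, fun i => hr i l, fun _ _ => rfl⟩
  choose b M hbM using haff
  refine ⟨a, ∑ l, (EuclideanSpace.proj l : Space d →L[ℝ] ℝ).smulRight (b l), M, ?_⟩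
  ext x i
  have h : ∀ l, MvPolynomial.eval (fun m => (x m : ℂ)) (r i l) = b l i + M l x i := fun l =>
    congrFun (congrFun (hbM l) x) i
  rw [hfq, hqr]
  simp only [map_add, map_sum, map_mul, MvPolynomial.eval_C, MvPolynomial.eval_X, h]
  simp [Finset.sum_apply, mul_add, Finset.sum_add_distrib, add_assoc]

end Polynomial

/-! ### The action of real matrices on complex vectors. -/

section Act

variable {d n : ℕ} (M N : Matrix (Fin n) (Fin n) ℝ) (x y : Fin n → ℂ)

theorem act_add_left : act (M + N) x = act M x + act N x := by
  rw [act, act, act, ← Matrix.add_mulVec]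
  congr 1
  ext i j; simp

theorem act_smul_left (r : ℝ) : act (r • M) x = r • act M x := by
  rw [act, act, ← Matrix.smul_mulVec]
  congr 1
  ext i j; simp

theorem act_zero_left : act (0 : Matrix (Fin n) (Fin n) ℝ) x = 0 := by
  simpa using act_smul_left (0 : Matrix (Fin n) (Fin n) ℝ) x 0

theorem act_neg_left : act (-M) x = -act M x := by
  simpa using act_smul_left M x (-1)

theorem act_sum_left {ι : Type*} (s : Finset ι) (M : ι → Matrix (Fin n) (Fin n) ℝ) :
    act (∑ i ∈ s, M i) x = ∑ i ∈ s, act (M i) x :=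
  map_sum (⟨⟨fun M => act M x, act_zero_left x⟩, fun M N => act_add_left M N x⟩ :
    Matrix (Fin n) (Fin n) ℝ →+ (Fin n → ℂ)) M s

/-- The action of a real matrix on `ℂ^n` as a linear map. -/
noncomputable def actLinear : (Fin n → ℂ) →ₗ[ℂ] (Fin n → ℂ) :=
  (M.map (fun a => (a : ℂ))).mulVecLin

theorem act_sub_right : act M (x - y) = act M x - act M y := map_sub (actLinear M) x y

theorem act_smul_right (r : ℝ) : act M (r • x) = r • act M x :=
  ((actLinear M).restrictScalars ℝ).map_smul r x

theorem act_sum_right {ι : Type*} (s : Finset ι) (x : ι → Fin n → ℂ) :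
    act M (∑ i ∈ s, x i) = ∑ i ∈ s, act M (x i) := map_sum (actLinear M) x s

variable (A : Fin d → Matrix (Fin n) (Fin n) ℝ)

theorem act_dirMat (v : Space d) : act (dirMat A v) x = ∑ i, v i • act (A i) x := by
  rw [dirMat, act_sum_left]
  simp only [act_smul_left]

theorem dirMat_neg (v : Space d) : dirMat A (-v) = -dirMat A v := by
  simp [dirMat]

/-- The same S diagonalizes -M, with -Λ in place of Λ. -/
theorem matAbs_neg {M S : Matrix (Fin n) (Fin n) ℝ} {l : Fin n → ℝ}
    (h : IsDiagonalization M S l) : matAbs (-M) = matAbs M := by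
  have h' : IsDiagonalization (-M) S (-l) := by
    refine ⟨h.1, ?_⟩
    rw [h.2, ← Matrix.neg_mul, ← Matrix.mul_neg, Matrix.diagonal_neg]
    rfl
  rw [matAbs_eq h, matAbs_eq h']
  simp

end Act

/-! ### Derivatives and translates of quadratic functions. -/

section Quadratic

variable {d n : ℕ} (a : Fin n → ℂ) (L : Space d →L[ℝ] Fin n → ℂ)
  (M : Fin d → Space d →L[ℝ] Fin n → ℂ)

theorem contDiff_quadratic : ContDiff ℝ 1 fun x : Space d => a + L x + ∑ l, x l • M l x := by
  fun_prop

theorem fderiv_quadratic (x e : Space d) :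
    fderiv ℝ (fun x : Space d => a + L x + ∑ l, x l • M l x) x e =
      L e + (∑ l, (e l • M l + (EuclideanSpace.proj l : Space d →L[ℝ] ℝ).smulRight (M l e))) x := by
  have h1 : ∀ l, HasFDerivAt (fun x : Space d => x l • M l x)
      (x l • M l + (EuclideanSpace.proj l : Space d →L[ℝ] ℝ).smulRight (M l x)) x := fun l =>
    (EuclideanSpace.proj l : Space d →L[ℝ] ℝ).hasFDerivAt.smul (M l).hasFDerivAt
  have h2 := (L.hasFDerivAt.const_add a).add
    (HasFDerivAt.fun_sum fun l (_ : l ∈ Finset.univ) => h1 l)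
  erw [h2.fderiv]
  simp [add_comm]

theorem quadratic_sub_translate (v : Space d) :
    ∃ (b : Fin n → ℂ) (L' : Space d →L[ℝ] Fin n → ℂ), ∀ x : Space d,
      (a + L x + ∑ l, x l • M l x) - (a + L (v + x) + ∑ l, (v + x) l • M l (v + x)) = b + L' x := by
  refine ⟨-(L v + ∑ l, v l • M l v),
    -∑ l, (v l • M l + (EuclideanSpace.proj l : Space d →L[ℝ] ℝ).smulRight (M l v)), fun x => ?_⟩
  simp only [map_add, PiLp.add_apply, smul_add, add_smul, Finset.sum_add_distrib,
    neg_apply, sum_apply, add_apply,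
    smul_apply, ContinuousLinearMap.smulRight_apply, PiLp.proj_apply]
  abel

end Quadratic

/-! ### Flux defects and their cancellation over a period. -/

namespace PeriodicMesh

variable {d n : ℕ} {B : Type*} {T : PeriodicMesh d B} {j k : T.Elem}
  {A : Fin d → Matrix (Fin n) (Fin n) ℝ}

theorem flux_sub (C : T.SimplexChoice) (u v : T.MeshFun n) (j k : T.Elem) :
    T.flux A C (u - v) j k = T.flux A C u j k - T.flux A C v j k := by
  simp only [flux, recon_sub, act_sub_right]
  abel

theorem PlanarFaces.flux_shift (hT : T.PlanarFaces) (C : T.SimplexChoice) (u : T.MeshFun n)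
    (hk : k ∈ T.nbr j) (z : Fin d → ℤ) :
    T.flux A C u (T.shift z j) (T.shift z k) = T.flux A C (fun m => u (T.shift z m)) j k := by
  rw [flux, hT.faceNormal_shift hk, hT.recon_shift C u hk, hT.recon_shift C u (mem_nbr_comm.1 hk),
    flux]

/-- Conservation: reversing the normal exchanges the two upwind matrices up to sign, because |-M| =
|M|. -/
theorem PlanarFaces.flux_comm (hA : IsHyperbolic A) (hT : T.PlanarFaces) (C : T.SimplexChoice)
    (u : T.MeshFun n) (hk : k ∈ T.nbr j) : T.flux A C u k j = -T.flux A C u j k := by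
  obtain ⟨S, l, h⟩ := hA (T.faceNormal j k)
  rw [flux, flux, hT.faceNormal_comm hk, dirMat_neg, matAbs_neg h]
  simp only [sub_eq_add_neg, act_smul_left, act_add_left, act_neg_left, smul_add, smul_neg]
  abel

/-- The reconstructions from the two sides agree at the common face center, so the terms with
|A·n_jk| cancel. -/
theorem flux_affine (hdef : ∀ j, ∀ k ∈ T.nbr j, T.MinusDefined j k ∧ T.PlusDefined j k)
    (C : T.SimplexChoice) (hk : k ∈ T.nbr j) (a : Fin n → ℂ) (L : Space d →L[ℝ] Fin n → ℂ) :
    T.flux A C (T.pointValues fun x => a + L x) j k =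
      act (dirMat A (T.faceNormal j k)) (a + L (T.faceCenter j k)) := by
  rw [flux, recon_affine C hk (hdef j k hk),
    recon_affine C (mem_nbr_comm.1 hk) (hdef k j (mem_nbr_comm.1 hk)), T.faceCenter_comm k j,
    ← act_add_left, ← smul_add, add_add_sub_cancel, ← two_smul ℝ, smul_smul]
  norm_num

/-- The difference of the numerical flux and the exact flux through the face. -/
noncomputable def fluxDefect (A : Fin d → Matrix (Fin n) (Fin n) ℝ) (C : T.SimplexChoice)
    (f : Space d → Fin n → ℂ) (j k : T.Elem) : Fin n → ℂ :=
  T.flux A C (T.pointValues f) j k -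
    act (dirMat A (T.faceNormal j k)) (⨍ x in T.face j k, f x ∂μHE[d - 1])

theorem PlanarFaces.fluxDefect_affine (hT : T.PlanarFaces)
    (hdef : ∀ j, ∀ k ∈ T.nbr j, T.MinusDefined j k ∧ T.PlusDefined j k)
    (C : T.SimplexChoice) (hk : k ∈ T.nbr j) (a : Fin n → ℂ) (L : Space d →L[ℝ] Fin n → ℂ) :
    fluxDefect A C (fun x => a + L x) j k = 0 := by
  rw [fluxDefect, flux_affine hdef C hk, hT.setAverage_face_affine hk, sub_self]

theorem PlanarFaces.fluxDefect_comm (hA : IsHyperbolic A) (hT : T.PlanarFaces)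
    (C : T.SimplexChoice) (f : Space d → Fin n → ℂ) (hk : k ∈ T.nbr j) :
    fluxDefect A C f k j = -fluxDefect A C f j k := by
  rw [fluxDefect, fluxDefect, hT.flux_comm hA C _ hk, hT.faceNormal_comm hk, dirMat_neg,
    act_neg_left, T.face_comm k j]
  abel

theorem PlanarFaces.fluxDefect_shift (hT : T.PlanarFaces) (C : T.SimplexChoice)
    (f : Space d → Fin n → ℂ) (hk : k ∈ T.nbr j) (z : Fin d → ℤ) :
    fluxDefect A C f (T.shift z j) (T.shift z k) =
      fluxDefect A C (fun x => f (intVec z + x)) j k := by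
  rw [fluxDefect, fluxDefect, hT.flux_shift C _ hk, hT.faceNormal_shift hk, face_shift,
    setAverage_image_add_left]
  simp only [pointValues, center_shift]
  rfl

theorem PlanarFaces.fluxDefect_sub (hT : T.PlanarFaces) (C : T.SimplexChoice)
    {f g : Space d → Fin n → ℂ} (hf : Continuous f) (hg : Continuous g) (hk : k ∈ T.nbr j) :
    fluxDefect A C (fun x => f x - g x) j k = fluxDefect A C f j k - fluxDefect A C g j k := by
  have hint : ∀ f : Space d → Fin n → ℂ, Continuous f → IntegrableOn f (T.face j k) μHE[d - 1] := by
    intro f hf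
    obtain ⟨R, hR⟩ := (T.isCompact_face j k).exists_bound_of_continuousOn hf.continuousOn
    exact Measure.integrableOn_of_bounded (hT.measure_face_ne_top hk) hf.aestronglyMeasurable
      ((ae_restrict_mem (T.measurableSet_face j k)).mono fun x hx => hR x hx)
  have h1 : T.pointValues (fun x => f x - g x) = T.pointValues f - T.pointValues g := rfl
  simp only [fluxDefect, h1, flux_sub, setAverage_eq]
  rw [integral_sub (hint f hf) (hint g hg), smul_sub, act_sub_right]
  abel

variable [Fintype B]

theorem PlanarFaces.vol_smul_truncError (hT : T.PlanarFaces) (hd : 1 ≤ d) (C : T.SimplexChoice)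
    (a : Fin n → ℂ) (L : Space d →L[ℝ] Fin n → ℂ) (M : Fin d → Space d →L[ℝ] Fin n → ℂ)
    (j : T.Elem) :
    T.vol j • T.truncError A (T.spatialOp A C) (fun x => a + L x + ∑ l, x l • M l x) j =
      ∑ k ∈ (T.nbr_finite j).toFinset,
        fluxDefect A C (fun x => a + L x + ∑ l, x l • M l x) j k := by
  set f : Space d → Fin n → ℂ := fun x => a + L x + ∑ l, x l • M l x with hf
  -- The derivative of a quadratic function is affine, so its value at the mass center is its mean
  -- over the element.
  have hvol : T.vol j • advect A f (T.center j) =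
      ∑ i, act (A i) (∫ x in T.cell j, fderiv ℝ f x (EuclideanSpace.single i 1)) := by
    rw [advect, Finset.smul_sum]
    refine Finset.sum_congr rfl fun i _ => ?_
    rw [← act_smul_right]
    simp only [hf, fderiv_quadratic]
    rw [setIntegral_affine (T.isPolytope j).isCompact (volume_cell_ne_zero j)
      (volume_cell_ne_top j)]
    rfl
  have hdiv : T.vol j • advect A f (T.center j) = ∑ k ∈ (T.nbr_finite j).toFinset,
      act (dirMat A (T.faceNormal j k)) (⨍ x in T.face j k, f x ∂μHE[d - 1]) := by
    rw [hvol]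
    simp only [act_dirMat]
    rw [Finset.sum_comm]
    refine Finset.sum_congr rfl fun i _ => ?_
    rw [hT.setIntegral_fderiv_cell hd j (contDiff_quadratic a L M), act_sum_right]
    refine Finset.sum_congr rfl fun k _ => ?_
    rw [act_smul_right, EuclideanSpace.inner_single_right]
    simp [hf]
  simp only [fluxDefect, Finset.sum_sub_distrib, ← hdiv]
  rw [truncError, spatialOp, smul_add, smul_inv_smul₀ (vol_ne_zero j), smul_neg, pointValues]
  abel

theorem PlanarFaces.isExact_one (hT : T.PlanarFaces) (hd : 1 ≤ d)
    (hdef : ∀ j, ∀ k ∈ T.nbr j, T.MinusDefined j k ∧ T.PlusDefined j k) (C : T.SimplexChoice) :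
    T.IsExact A (T.spatialOp A C) 1 := by
  intro f hf j
  obtain ⟨a, L, rfl⟩ := hf.exists_affine
  have h := hT.vol_smul_truncError (A := A) hd C a L 0 j
  simp only [Pi.zero_apply, zero_apply, smul_zero, Finset.sum_const_zero,
    add_zero] at h
  rw [Finset.sum_eq_zero fun k hk =>
    hT.fluxDefect_affine hdef C ((T.nbr_finite j).mem_toFinset.1 hk) a L] at h
  exact (smul_eq_zero.1 h).resolve_left (vol_ne_zero j)

theorem PlanarFaces.hasZeroMeanError_two (hA : IsHyperbolic A) (hT : T.PlanarFaces) (hd : 1 ≤ d)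
    (hdef : ∀ j, ∀ k ∈ T.nbr j, T.MinusDefined j k ∧ T.PlusDefined j k) (C : T.SimplexChoice) :
    T.HasZeroMeanError A (T.spatialOp A C) 2 := by
  intro f hf
  obtain ⟨a, L, M, rfl⟩ := hf.exists_quadratic
  simp only [hT.vol_smul_truncError hd C a L M]
  set f : Space d → Fin n → ℂ := fun x => a + L x + ∑ l, x l • M l x with hf
  have hfc : Continuous f := (contDiff_quadratic a L M).continuous
  -- The function f is not periodic, but it differs from its translate by an affine function, whose
  -- defect vanishes.
  have hshift : ∀ (j k : T.Elem) (z : Fin d → ℤ), k ∈ T.nbr j →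
      fluxDefect A C f (T.shift z j) (T.shift z k) = fluxDefect A C f j k := by
    intro j k z hk
    obtain ⟨b, L', h⟩ := quadratic_sub_translate a L M (intVec z)
    have h1 := hT.fluxDefect_sub (A := A) C (g := fun x => f (intVec z + x)) hfc (by fun_prop) hk
    have h2 : (fun x => f x - f (intVec z + x)) = fun x => b + L' x := funext h
    rw [h2, hT.fluxDefect_affine hdef C hk] at h1
    rw [hT.fluxDefect_shift C f hk]
    exact (sub_eq_zero.1 h1.symm).symm
  -- The face between (0, b) and (z, b') is seen from its other side after translation by -z, which
  -- brings (z, b') back to the reference period.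
  have hpair : ∀ (b b' : B) (z : Fin d → ℤ), (z, b') ∈ T.nbr (0, b) → (-z, b) ∈ T.nbr (0, b') ∧
      fluxDefect A C f (0, b') (-z, b) = -fluxDefect A C f (0, b) (z, b') := by
    intro b b' z h
    have h1 : T.shift (-z) (z, b') = (0, b') := by simp [shift]
    have h2 : T.shift (-z) (0, b) = (-z, b) := by simp [shift]
    have h' := mem_nbr_comm.1 h
    refine ⟨?_, ?_⟩
    · rw [← h1, ← h2]
      exact shift_mem_nbr.2 h'
    · rw [← hT.fluxDefect_comm hA C f h, ← hshift _ _ (-z) h', h1, h2]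
  rw [Finset.sum_sigma']
  refine Finset.sum_involution (fun p _ => ⟨p.2.2, (-p.2.1, p.1)⟩) ?_ ?_ ?_ ?_
  · rintro ⟨b, z, b'⟩ hp
    have hp : (z, b') ∈ T.nbr (0, b) := by simpa using hp
    simp only [(hpair b b' z hp).2, add_neg_cancel]
  -- A pair fixed by the involution has a defect equal to its own negative, hence zero.
  · rintro ⟨b, z, b'⟩ hp hne heq
    have hp : (z, b') ∈ T.nbr (0, b) := by simpa using hp
    have h := (hpair b b' z hp).2
    simp only [Sigma.mk.injEq, heq_eq_eq, Prod.mk.injEq] at heq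
    obtain ⟨rfl, hz, -⟩ := heq
    rw [hz] at h
    exact hne (self_eq_neg.1 h)
  · rintro ⟨b, z, b'⟩ hp
    have hp : (z, b') ∈ T.nbr (0, b) := by simpa using hp
    simpa using (hpair b b' z hp).1
  · rintro ⟨b, z, b'⟩ hp
    simp

end PeriodicMesh

end BBR

theorem mainTheorem8 {d n : ℕ} (hd : 1 ≤ d) {B : Type*} [Fintype B]
    (A : Fin d → Matrix (Fin n) (Fin n) ℝ) (hA : BBR.IsHyperbolic A)
    (T : BBR.PeriodicMesh d B) (hT : T.PlanarFaces)
    (hdef : ∀ j, ∀ k ∈ T.nbr j, T.MinusDefined j k ∧ T.PlusDefined j k)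
    (C : T.SimplexChoice) :
    T.IsExact A (T.spatialOp A C) 1 ∧ T.HasZeroMeanError A (T.spatialOp A C) 2 :=
  ⟨hT.isExact_one hd hdef C, hT.hasZeroMeanError_two hA hd hdef C⟩
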